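/- Let $\Omega\subseteq\mathbb{R}^d$ be open, let $D\subseteq\partial\Omega$ be closed, and let $V$ be the closure in $W^{1,2}(\Omega)$ (complex-valued functions) of either $\{u|_\Omega : u\in C_c^\infty(\mathbb{R}^d),\ \operatorname{dist}(\operatorname{supp}u,D)>0\}$ or $\{u\in W^{1,2}(\Omega) : \operatorname{dist}(\operatorname{supp}u,D)>0\}$. Let $\mu\colon\Omega\to\mathcal{L}(\mathbb{C}^d)$ be Lebesgue measurable, (essentially) bounded and uniformly elliptic, i.e. there is $m_\bullet>0$ with $\operatorname{Re}(\mu(x)\xi,\xi)\ge m_\bullet|\xi|^2$ for all $\xi\in\mathbb{C}^d$ and almost every $x\in\Omega$. Let $A$ be the operator in $L^2(\Omega)$ induced by the form $\mathfrak{t}(u,v)=\int_\Omega(\mu\nabla u,\nabla v)\,\mathrm{d}x$ on $V$: $u\in\operatorname{dom}(A)$ and $Au=f$ if and only if $u\in V$, $f\in L^2(\Omega)$ and $\mathfrak{t}(u,v)=(f,v)_{L^2(\Omega)}$ for all $v\in V$. Let $T$ be the strongly continuous semigroup on $L^2(\Omega)$ generated by $-A$. Let $p\in(1,\infty)$, $\frac1p+\frac1{p'}=1$.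 Let $A_p$ be the realization of $A$ in $L^p(\Omega)$, i.e. the negative generator of the strongly continuous semigroup $T_p$ on $L^p(\Omega)$ to which $T$ extrapolates, $T_p(t)f=T(t)f$ for all $t\ge0$ and $f\in L^2(\Omega)\cap L^p(\Omega)$. For $\theta\in[0,\frac\pi2]$ let $\Sigma_\theta=\{z\in\mathbb{C}:|\arg z|\le\theta\}\cup\{0\}$; let $\mathcal{J}_p(\alpha+\mathrm{i}\beta)=\frac{2\alpha}{p'}+\mathrm{i}\frac{2\beta}{p}$ for $\alpha,\beta\in\mathbb{R}^d$; and for $L\in\mathcal{L}(\mathbb{C}^d)$ let $N_p(L)=\{(L\xi,\mathcal{J}_p\xi):\xi\in\mathbb{C}^d,\ |\xi|=1\}$ be its $p$-numerical range. The numerical range of $A_p$ is $$N(A_p)=\{u^*(A_pu) : u\in\operatorname{dom}(A_p),\ \|u\|_{L^p(\Omega)}=1,\ u^*\in L^p(\Omega)^*,\ u^*(u)=\|u\|_{L^p(\Omega)},\ \|u^*\|=1\}.$$ If $\theta\in[0,\frac\pi2]$ is such that $N_p(\mu(x))\subseteq\Sigma_\theta$ for almost every $x\in\Omega$, then $N(A_p)\subseteq\Sigma_\theta$.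 -/

import Mathlib

open MeasureTheory Filter Topology
open scoped ENNReal NNReal ContDiff

noncomputable section

namespace EllipticLp

/-! ### Sectors, duality mapping and numerical ranges -/

/-- The closed sector `Σ_θ = {z : |arg z| ≤ θ} ∪ {0}`. -/
def sector (θ : ℝ) : Set ℂ := {z | |z.arg| ≤ θ} ∪ {0}

section Banach

variable {X : Type*} [NormedAddCommGroup X] [NormedSpace ℂ X]

/-- The (set-valued) duality mapping `J(u) = {u* ∈ X* : u*(u) = ‖u‖, ‖u*‖ = 1}`. -/
def dualityMap (u : X) : Set (StrongDual ℂ X) := {φ | φ u = (‖u‖ : ℂ) ∧ ‖φ‖ = 1}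

/-- The numerical range `{u*(B u) : u ∈ dom B, ‖u‖ = 1, u* ∈ J(u)}` of an operator `B` in a Banach
space. Unbounded operators are given by their graphs: `(u, f) ∈ B` means `u ∈ dom B`, `B u = f`. -/
def numericalRange (B : Set (X × X)) : Set ℂ :=
  {z | ∃ u f, (u, f) ∈ B ∧ ‖u‖ = 1 ∧ ∃ φ ∈ dualityMap u, z = φ f}

/-- Strongly continuous one-parameter semigroups of bounded operators. -/
structure IsC0Semigroup (T : ℝ≥0 → X →L[ℂ] X) : Prop where
  map_zero : T 0 = ContinuousLinearMap.id ℂ X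
  map_add : ∀ s t, T (s + t) = (T s).comp (T t)
  continuous : ∀ u, Continuous fun t => T t u

/-- The graph of the negative generator of `T`: `u` is in its domain, with value `f`, if and only if
`t⁻¹ (u - T(t) u) → f` as `t ↓ 0`. -/
def negGenerator (T : ℝ≥0 → X →L[ℂ] X) : Set (X × X) :=
  {w | Tendsto (fun t : ℝ≥0 => (((t : ℝ) : ℂ))⁻¹ • (w.1 - T t w.1)) (𝓝[>] 0) (𝓝 w.2)}

end Banach

/-! ### The `p`-numerical range of a matrix -/

/-- Complex `d`-space with its Euclidean norm. -/
abbrev Cd (d : ℕ) : Type := EuclideanSpace ℂ (Fin d)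

/-- Real `d`-space with its Euclidean norm. -/
abbrev Rd (d : ℕ) : Type := EuclideanSpace ℝ (Fin d)

/-- The real-linear map `𝒥_p (α + i β) = 2 α / p' + i 2 β / p` on `ℂ^d`, where `1/p + 1/p' = 1`. -/
def Jp {d : ℕ} (p : ℝ) (ξ : Cd d) : Cd d :=
  WithLp.toLp 2 fun i => ⟨2 * (ξ i).re / p.conjExponent, 2 * (ξ i).im / p⟩

/-- The `p`-numerical range `N_p(L) = {(L ξ, 𝒥_p ξ) : |ξ| = 1}`. The inner product `(a, b)`, linear
in `a`, is `inner ℂ b a` in Mathlib's convention. -/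
def pNumericalRange {d : ℕ} (p : ℝ) (L : Cd d →L[ℂ] Cd d) : Set ℂ :=
  {z | ∃ ξ : Cd d, ‖ξ‖ = 1 ∧ z = inner ℂ (Jp p ξ) (L ξ)}

/-! ### The Sobolev space `W^{1,2}(Ω)` and the form domains -/

/-- The complex Lebesgue space `L^p(Ω)`. -/
abbrev LpΩ {d : ℕ} (p : ℝ≥0∞) (Ω : Set (Rd d)) : Type :=
  Lp ℂ p (volume.restrict Ω)

/-- The space `L^2(Ω; ℂ^d)` of square integrable vector fields. -/
abbrev L2Field {d : ℕ} (Ω : Set (Rd d)) : Type :=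
  Lp (Cd d) 2 (volume.restrict Ω)

/-- `g` is the weak gradient of `u` on `Ω`. -/
def IsWeakGradient {d : ℕ} (Ω : Set (Rd d)) (u : Rd d → ℂ) (g : Rd d → Cd d) : Prop :=
  ∀ φ : Rd d → ℝ, ContDiff ℝ ∞ φ → HasCompactSupport φ → tsupport φ ⊆ Ω → ∀ i : Fin d,
    ∫ x in Ω, (fderiv ℝ φ x (EuclideanSpace.single i 1)) • u x = - ∫ x in Ω, φ x • g x i

/-- `W^{1,2}(Ω)`; an element is recorded together with its (unique) weak gradient, as the pair
`(u, ∇u) ∈ L^2(Ω) × L^2(Ω; ℂ^d)`. The topology of `W^{1,2}(Ω)` is the one induced by that product. -/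
def W12 {d : ℕ} (Ω : Set (Rd d)) : Set (LpΩ 2 Ω × L2Field Ω) :=
  {w | IsWeakGradient Ω w.1 w.2}

/-- The essential support of `u` on `Ω`: the points near which `u` does not vanish a.e. -/
def essSupport {d : ℕ} (Ω : Set (Rd d)) (u : Rd d → ℂ) : Set (Rd d) :=
  {x | ∀ U ∈ 𝓝 x, ¬ ∀ᵐ y ∂(volume.restrict Ω), y ∈ U → u y = 0}

/-- The restrictions to `Ω` of the functions in `C_c^∞(ℝ^d)` whose support has positive distance
to `D` (with `dist(∅, D) = dist(S, ∅) = ∞`), as elements of `W^{1,2}(Ω)`. -/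
def smoothD {d : ℕ} (Ω D : Set (Rd d)) : Set (LpΩ 2 Ω × L2Field Ω) :=
  {w | w ∈ W12 Ω ∧ ∃ φ : Rd d → ℂ, ContDiff ℝ ∞ φ ∧ HasCompactSupport φ ∧
    Metric.AreSeparated (tsupport φ) D ∧ w.1 =ᵐ[volume.restrict Ω] φ}

/-- The functions in `W^{1,2}(Ω)` whose support has positive distance to `D`. -/
def sobolevD {d : ℕ} (Ω D : Set (Rd d)) : Set (LpΩ 2 Ω × L2Field Ω) :=
  {w | w ∈ W12 Ω ∧ Metric.AreSeparated (essSupport Ω w.1) D}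

/-- `V` is one of the two admissible form domains with Dirichlet condition on `D`: the closure in
`W^{1,2}(Ω)` of `smoothD Ω D` or of `sobolevD Ω D`. -/
def IsFormDomain {d : ℕ} (Ω D : Set (Rd d)) (V : Set (LpΩ 2 Ω × L2Field Ω)) : Prop :=
  V = W12 Ω ∩ closure (smoothD Ω D) ∨ V = W12 Ω ∩ closure (sobolevD Ω D)

/-! ### The form, the operator on `L^2(Ω)`, and extrapolation to `L^p(Ω)` -/

/-- The sesquilinear form `𝔱(u, v) = ∫_Ω (μ ∇u, ∇v) dx`. -/
def form {d : ℕ} (Ω : Set (Rd d)) (μ : Rd d → Cd d →L[ℂ] Cd d)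
    (w z : LpΩ 2 Ω × L2Field Ω) : ℂ :=
  ∫ x in Ω, inner ℂ (z.2 x) (μ x (w.2 x))

/-- The graph of the operator `A` induced on `L^2(Ω)` by the form restricted to `V`: `A u = f` iff
`u ∈ V` and `𝔱(u, v) = (f, v)_{L^2(Ω)}` for all `v ∈ V`. -/
def formOperator {d : ℕ} (Ω : Set (Rd d)) (μ : Rd d → Cd d →L[ℂ] Cd d)
    (V : Set (LpΩ 2 Ω × L2Field Ω)) : Set (LpΩ 2 Ω × LpΩ 2 Ω) :=
  {a | ∃ w ∈ V, w.1 = a.1 ∧ ∀ z ∈ V, form Ω μ w z = inner ℂ z.1 a.2}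

/-- The families `T` on `L^2(Ω)` and `S` on `L^p(Ω)` agree on `L^2(Ω) ∩ L^p(Ω)`. -/
def Consistent {d : ℕ} {Ω : Set (Rd d)} {p : ℝ≥0∞} [Fact (1 ≤ p)]
    (T : ℝ≥0 → LpΩ 2 Ω →L[ℂ] LpΩ 2 Ω) (S : ℝ≥0 → LpΩ p Ω →L[ℂ] LpΩ p Ω) : Prop :=
  ∀ (t : ℝ≥0) (f : LpΩ 2 Ω) (g : LpΩ p Ω), f =ᵐ[volume.restrict Ω] g →
    T t f =ᵐ[volume.restrict Ω] S t g

/-- `B` is (the graph of) the realization `A_p` in `L^p(Ω)` of an operator `A` in `L^2(Ω)`: `-A`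
generates a strongly continuous semigroup `T` on `L^2(Ω)`, which extrapolates consistently to a
strongly continuous semigroup `T_p` on `L^p(Ω)`, and `-B` is the generator of `T_p`. As `A`
determines `T`, and `T` determines `T_p` by density, there is at most one such `B`. -/
def IsLpRealization {d : ℕ} {Ω : Set (Rd d)} {p : ℝ≥0∞} [Fact (1 ≤ p)]
    (A : Set (LpΩ 2 Ω × LpΩ 2 Ω)) (B : Set (LpΩ p Ω × LpΩ p Ω)) : Prop :=
  ∃ (T : ℝ≥0 → LpΩ 2 Ω →L[ℂ] LpΩ 2 Ω) (Tp : ℝ≥0 → LpΩ p Ω →L[ℂ] LpΩ p Ω),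
    IsC0Semigroup T ∧ negGenerator T = A ∧ IsC0Semigroup Tp ∧ Consistent T Tp ∧ negGenerator Tp = B

end EllipticLp

end

noncomputable section

namespace EllipticLp

/-! ### Sectors as intersections of half-planes -/

/-- The rotations that turn the half-planes cutting out the sector `Σ_θ` into `{Re z ≥ 0}`. -/
def sectorRotations (θ : ℝ) : Set ℂ :=
  {1, ⟨Real.sin θ, Real.cos θ⟩, ⟨Real.sin θ, -Real.cos θ⟩}

theorem mem_sector_iff {θ : ℝ} (h0 : 0 ≤ θ) (h1 : θ ≤ Real.pi / 2) {z : ℂ} :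
    z ∈ sector θ ↔ ∀ c ∈ sectorRotations θ, 0 ≤ (c * z).re := by
  have key : (∀ c ∈ sectorRotations θ, 0 ≤ (c * z).re) ↔
      0 ≤ z.re ∧ |z.im| * Real.cos θ ≤ z.re * Real.sin θ := by
    have hc : 0 ≤ Real.cos θ := Real.cos_nonneg_of_mem_Icc ⟨by linarith, h1⟩
    simp only [sectorRotations, Set.mem_insert_iff, Set.mem_singleton_iff, forall_eq_or_imp,
      forall_eq, Complex.mul_re, Complex.one_re, Complex.one_im, one_mul, zero_mul, sub_zero]
    refine and_congr_right fun _ => ?_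
    rw [← abs_of_nonneg hc, ← abs_mul, abs_le, abs_of_nonneg hc]
    constructor <;> rintro ⟨a, b⟩ <;> constructor <;> linarith
  rw [key]
  rcases eq_or_ne z 0 with rfl | hz
  · simp [sector]
  have hn : 0 < ‖z‖ := norm_pos_iff.2 hz
  have hre : ‖z‖ * Real.cos |z.arg| = z.re := by rw [Real.cos_abs, Complex.norm_mul_cos_arg]
  have him : ‖z‖ * Real.sin |z.arg| = |z.im| := by
    rw [← Real.abs_sin_eq_sin_abs_of_abs_le_pi (Complex.abs_arg_le_pi z),
      ← abs_of_pos hn, ← abs_mul, Complex.norm_mul_sin_arg]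
  have hsin : z.re * Real.sin θ - |z.im| * Real.cos θ = ‖z‖ * Real.sin (θ - |z.arg|) := by
    rw [← hre, ← him, Real.sin_sub]; ring
  have hmem : z ∈ sector θ ↔ |z.arg| ≤ θ := by simp [sector, hz]
  rw [hmem]
  constructor
  · intro h
    refine ⟨Complex.abs_arg_le_pi_div_two_iff.1 (h.trans h1), ?_⟩
    have : 0 ≤ Real.sin (θ - |z.arg|) :=
      Real.sin_nonneg_of_nonneg_of_le_pi (by linarith) (by
        linarith [abs_nonneg z.arg, Real.pi_pos])
    nlinarith
  · rintro ⟨ha, hb⟩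
    by_contra! hlt
    have h2 := Complex.abs_arg_le_pi_div_two_iff.2 ha
    have : 0 < Real.sin (|z.arg| - θ) :=
      Real.sin_pos_of_pos_of_lt_pi (by linarith) (by linarith [Real.pi_pos])
    rw [← neg_sub, Real.sin_neg] at this
    nlinarith

/-! ### The radial cut-off functions -/

/-- The function `z ↦ |z|^{p-2} z`. -/
def powerMap (p : ℝ) (z : ℂ) : ℂ := ((‖z‖ ^ (p - 2) : ℝ) : ℂ) * z

/-- The ratio `(ε + q) / (1 + ε q)`, which regularizes the identity on `[0, ∞)`. -/
def regRatio (ε q : ℝ) : ℝ := (ε + q) / (1 + ε * q)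

/-- A smooth approximation of `z ↦ |z|^{p-2} z` with bounded derivative. -/
def regPower (p ε : ℝ) (z : ℂ) : ℂ := (regRatio ε (‖z‖ ^ 2) ^ ((p - 2) / 2)) • z

theorem norm_powerMap {p : ℝ} (hp : 1 < p) (z : ℂ) : ‖powerMap p z‖ = ‖z‖ ^ (p - 1) := by
  rw [powerMap, norm_mul, Complex.norm_real, Real.norm_of_nonneg (by positivity)]
  rcases eq_or_ne z 0 with rfl | hz
  · simp [Real.zero_rpow (by linarith : p - 1 ≠ 0)]
  · rw [← Real.rpow_add_one (norm_ne_zero_iff.2 hz)]; ring_nf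

theorem conj_powerMap_mul_self {p : ℝ} (hp : 1 < p) (z : ℂ) :
    starRingEnd ℂ (powerMap p z) * z = ((‖z‖ ^ p : ℝ) : ℂ) := by
  rw [powerMap, map_mul, Complex.conj_ofReal, mul_assoc, Complex.conj_mul']
  rcases eq_or_ne z 0 with rfl | hz
  · simp [Real.zero_rpow (by linarith : p ≠ 0)]
  · rw [← Complex.ofReal_pow, ← Complex.ofReal_mul, ← Real.rpow_natCast,
      ← Real.rpow_add (norm_pos_iff.2 hz)]
    norm_num

theorem continuous_powerMap {p : ℝ} (hp : 1 < p) : Continuous (powerMap p) := by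
  refine continuous_iff_continuousAt.2 fun z => ?_
  rcases eq_or_ne z 0 with rfl | hz
  · have h0 : powerMap p 0 = 0 := by simp [powerMap]
    rw [ContinuousAt, h0]
    refine squeeze_zero_norm (a := fun z : ℂ => ‖z‖ ^ (p - 1)) (fun w => (norm_powerMap hp w).le) ?_
    have := ((continuous_norm (E := ℂ)).rpow_const
      (fun _ => Or.inr (by linarith : 0 ≤ p - 1))).tendsto 0
    simpa [Real.zero_rpow (by linarith : p - 1 ≠ 0)] using this
  · exact (Complex.continuous_ofReal.continuousAt.comp
      ((continuous_norm.continuousAt).rpow_const (Or.inl (norm_ne_zero_iff.2 hz)))).mul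
      continuousAt_id

section Ratio

variable {ε q : ℝ}

theorem regRatio_pos (hε : 0 < ε) (hq : 0 ≤ q) : 0 < regRatio ε q := by
  unfold regRatio; positivity

theorem le_regRatio (hε : 0 < ε) (hε1 : ε ≤ 1) (hq : 0 ≤ q) : ε ≤ regRatio ε q := by
  rw [regRatio, le_div_iff₀ (by positivity)]
  nlinarith [mul_nonneg hε.le hq, mul_nonneg (sub_nonneg.2 hε1) hq]

theorem regRatio_le (hε : 0 < ε) (hε1 : ε ≤ 1) (hq : 0 ≤ q) : regRatio ε q ≤ ε⁻¹ := by
  rw [regRatio, div_le_iff₀ (by positivity)]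
  have : ε⁻¹ * (1 + ε * q) = ε⁻¹ + q := by field_simp
  rw [this]
  have := one_le_inv_iff₀.2 ⟨hε, hε1⟩
  linarith

/-- A power of a number in `[m, M]` is at most the sum of the powers of the endpoints. -/
theorem rpow_le_add_of_mem {m M x a : ℝ} (hm : 0 < m) (h1 : m ≤ x) (h2 : x ≤ M) :
    x ^ a ≤ m ^ a + M ^ a := by
  have hx : 0 < x := hm.trans_le h1
  have hM : 0 < M := hx.trans_le h2
  rcases le_total 0 a with ha | ha
  · linarith [Real.rpow_le_rpow hx.le h2 ha, Real.rpow_nonneg hm.le a]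
  · linarith [Real.rpow_le_rpow_of_nonpos hm h1 ha, Real.rpow_nonneg hM.le a]

theorem regRatio_rpow_le (hε : 0 < ε) (hε1 : ε ≤ 1) (hq : 0 < q) (a : ℝ) :
    regRatio ε q ^ a ≤ ((2⁻¹ : ℝ) ^ a + 2 ^ a) * (1 + q ^ a) := by
  have hl : min 1 q / 2 ≤ regRatio ε q := by
    rw [regRatio, le_div_iff₀ (by positivity)]
    rcases min_cases 1 q with ⟨h, h'⟩ | ⟨h, h'⟩ <;> rw [h] <;> nlinarith [mul_pos hε hq]
  have hu : regRatio ε q ≤ 2 * max 1 q := by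
    rw [regRatio, div_le_iff₀ (by positivity)]
    have h1 := le_max_left 1 q
    have h2 := le_max_right 1 q
    nlinarith [mul_pos hε hq]
  have hmin : 0 < min 1 q := lt_min one_pos hq
  have hmax : 0 < max 1 q := one_pos.trans_le (le_max_left _ _)
  refine (rpow_le_add_of_mem (by positivity) hl hu).trans ?_
  have hqa : 0 ≤ q ^ a := Real.rpow_nonneg hq.le a
  have e1 : (min 1 q) ^ a ≤ 1 + q ^ a := by
    rcases min_choice 1 q with h | h <;> rw [h] <;> simp [hqa]
  have e2 : (max 1 q) ^ a ≤ 1 + q ^ a := by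
    rcases max_choice 1 q with h | h <;> rw [h] <;> simp [hqa]
  rw [div_eq_mul_inv, mul_comm (min 1 q), Real.mul_rpow (by positivity) hmin.le,
    Real.mul_rpow (by positivity) hmax.le, add_mul]
  gcongr

theorem hasDerivAt_regRatio (hε : 0 < ε) (hq : 0 ≤ q) :
    HasDerivAt (regRatio ε) ((1 - ε ^ 2) / (1 + ε * q) ^ 2) q := by
  have h : 1 + ε * q ≠ 0 := by positivity
  convert! ((hasDerivAt_id q).const_add ε).div (((hasDerivAt_id q).const_mul ε).const_add 1) h using 1
  simp only [id]
  ring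

end Ratio

theorem contDiff_regPower {p ε : ℝ} (hε : 0 < ε) : ContDiff ℝ ∞ (regPower p ε) := by
  have hq : ContDiff ℝ ∞ fun z : ℂ => ‖z‖ ^ 2 := contDiff_norm_sq ℝ
  have hr : ContDiff ℝ ∞ fun z : ℂ => regRatio ε (‖z‖ ^ 2) :=
    (contDiff_const.add hq).div (contDiff_const.add (contDiff_const.mul hq))
      fun z => by positivity
  exact (hr.rpow_const_of_ne fun z => (regRatio_pos hε (by positivity)).ne').smul contDiff_id

theorem regPower_zero (p ε : ℝ) : regPower p ε 0 = 0 := by simp [regPower]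

/-- The derivative of `regPower`, in polar coordinates `z = |z| s`. -/
theorem fderiv_regPower {p ε : ℝ} (hε : 0 < ε) (hε1 : ε ≤ 1) (z : ℂ) :
    ∃ (m : ℝ) (s : ℂ), 0 ≤ m ∧ m ≤ 1 ∧ ‖s‖ = 1 ∧ ∀ h : ℂ, fderiv ℝ (regPower p ε) z h =
      ((regRatio ε (‖z‖ ^ 2) ^ ((p - 2) / 2) : ℝ) : ℂ) *
        (h + (((p - 2) * m * (starRingEnd ℂ s * h).re : ℝ) : ℂ) * s) := by
  obtain ⟨s, hs, hzs⟩ : ∃ s : ℂ, ‖s‖ = 1 ∧ z = ‖z‖ * s := by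
    rcases eq_or_ne z 0 with rfl | hz
    · exact ⟨1, by simp⟩
    · have : (‖z‖ : ℂ) ≠ 0 := by exact_mod_cast norm_ne_zero_iff.2 hz
      exact ⟨z / ‖z‖, by simp [norm_ne_zero_iff.2 hz], by field_simp⟩
  set q := ‖z‖ ^ 2 with hq
  have hq0 : 0 ≤ q := by positivity
  have hpos := regRatio_pos hε hq0
  have hd1 : 0 < 1 + ε * q := by positivity
  have hd2 : 0 < ε + q := by positivity
  refine ⟨q * (1 - ε ^ 2) / ((1 + ε * q) * (ε + q)), s, ?_, ?_, hs, fun h => ?_⟩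
  · have : 0 ≤ 1 - ε ^ 2 := by nlinarith
    positivity
  · rw [div_le_one (by positivity)]
    nlinarith [mul_nonneg hε.le hq0, mul_nonneg (mul_nonneg hε.le hq0) hq0,
      mul_nonneg (sq_nonneg ε) hq0]
  · have h1 : HasDerivAt (fun q => regRatio ε q ^ ((p - 2) / 2)) _ q :=
      (hasDerivAt_regRatio hε hq0).rpow_const (Or.inl hpos.ne')
    have h2 : HasFDerivAt (fun z : ℂ => ‖z‖ ^ 2) _ z := (hasStrictFDerivAt_norm_sq z).hasFDerivAt
    have h3 := (HasDerivAt.comp_hasFDerivAt z h1 h2).smul (hasFDerivAt_id z)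
    have h4 : fderiv ℝ (regPower p ε) z = _ := h3.fderiv
    rw [h4]
    have hre : inner ℝ z h = ‖z‖ * (starRingEnd ℂ s * h).re := by
      rw [Complex.inner]
      conv_lhs => rw [hzs]
      rw [map_mul, Complex.conj_ofReal, mul_left_comm, Complex.re_ofReal_mul, mul_comm h]
    simp only [Function.comp_apply, id_eq, add_apply,
      smul_apply, ContinuousLinearMap.smulRight_apply,
      ContinuousLinearMap.id_apply, innerSL_apply_apply, smul_eq_mul, hre, Complex.real_smul]
    rw [mul_add]
    congr 1
    have hz' : ∀ k : ℂ, k * z = k * ‖z‖ * s := fun k => by rw [mul_assoc, ← hzs]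
    rw [hz', ← mul_assoc, ← Complex.ofReal_mul, ← Complex.ofReal_mul]
    congr 2
    rw [Real.rpow_sub_one hpos.ne']
    generalize regRatio ε q ^ ((p - 2) / 2) = P
    rw [regRatio, nsmul_eq_mul]
    push_cast
    field_simp
    rw [hq]
    ring

theorem norm_fderiv_regPower_le {p ε : ℝ} (hε : 0 < ε) (hε1 : ε ≤ 1) (z : ℂ) :
    ‖fderiv ℝ (regPower p ε) z‖ ≤
      (ε ^ ((p - 2) / 2) + ε⁻¹ ^ ((p - 2) / 2)) * (1 + |p - 2|) := by
  obtain ⟨m, s, hm0, hm1, hs, h⟩ := fderiv_regPower (p := p) hε hε1 z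
  have hq : 0 ≤ ‖z‖ ^ 2 := by positivity
  refine ContinuousLinearMap.opNorm_le_bound _ (by positivity) fun w => ?_
  rw [h, norm_mul, Complex.norm_real,
    Real.norm_of_nonneg (Real.rpow_nonneg (regRatio_pos hε hq).le _), mul_assoc _ (1 + |p - 2|)]
  refine mul_le_mul (rpow_le_add_of_mem hε (le_regRatio hε hε1 hq) (regRatio_le hε hε1 hq)) ?_
    (norm_nonneg _) (by positivity)
  refine (norm_add_le _ _).trans ?_
  rw [norm_mul, hs, mul_one, Complex.norm_real, Real.norm_eq_abs, abs_mul, abs_mul,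
    abs_of_nonneg hm0, add_mul, one_mul]
  have h1 : |(starRingEnd ℂ s * w).re| ≤ ‖w‖ := by
    simpa [hs] using Complex.abs_re_le_norm (starRingEnd ℂ s * w)
  have h2 : |p - 2| * m ≤ |p - 2| := mul_le_of_le_one_right (abs_nonneg _) hm1
  gcongr

theorem tendsto_regPower (p : ℝ) (z : ℂ) :
    Tendsto (fun n : ℕ => regPower p (1 / ((n : ℝ) + 1)) z) atTop (𝓝 (powerMap p z)) := by
  rcases eq_or_ne z 0 with rfl | hz
  · simp [regPower_zero, powerMap]
  have hn : 0 < ‖z‖ := norm_pos_iff.2 hz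
  have ht : Tendsto (fun n : ℕ => (1 / ((n : ℝ) + 1))) atTop (𝓝 0) :=
    tendsto_one_div_add_atTop_nhds_zero_nat
  have h1 : Tendsto (fun n : ℕ => regRatio (1 / ((n : ℝ) + 1)) (‖z‖ ^ 2)) atTop
      (𝓝 (‖z‖ ^ 2)) := by
    have := (ht.add_const (‖z‖ ^ 2)).div ((ht.mul_const (‖z‖ ^ 2)).const_add 1) (by simp)
    simpa [regRatio, Pi.div_def] using this
  have h2 := (h1.rpow_const (p := (p - 2) / 2) (Or.inl (by positivity))).smul_const z
  have e : (‖z‖ ^ 2) ^ ((p - 2) / 2) = ‖z‖ ^ (p - 2) := by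
    rw [← Real.rpow_natCast, ← Real.rpow_mul hn.le]; congr 1; push_cast; ring
  rw [e, Complex.real_smul] at h2
  exact h2

theorem norm_regPower_le {p ε : ℝ} (hε : 0 < ε) (hε1 : ε ≤ 1) (z : ℂ) :
    ‖regPower p ε z‖ ≤ ((2⁻¹ : ℝ) ^ ((p - 2) / 2) + 2 ^ ((p - 2) / 2)) *
      (‖z‖ + ‖powerMap p z‖) := by
  rcases eq_or_ne z 0 with rfl | hz
  · simp [regPower_zero, powerMap]
  have hn : 0 < ‖z‖ := norm_pos_iff.2 hz
  have h := regRatio_rpow_le hε hε1 (q := ‖z‖ ^ 2) (by positivity) ((p - 2) / 2)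
  have e : (‖z‖ ^ 2) ^ ((p - 2) / 2) = ‖z‖ ^ (p - 2) := by
    rw [← Real.rpow_natCast, ← Real.rpow_mul hn.le]; congr 1; push_cast; ring
  rw [e] at h
  rw [regPower, norm_smul, Real.norm_of_nonneg
    (Real.rpow_nonneg (regRatio_pos hε (by positivity)).le _)]
  refine (mul_le_mul_of_nonneg_right h hn.le).trans (le_of_eq ?_)
  rw [powerMap, norm_mul, Complex.norm_real, Real.norm_of_nonneg (by positivity)]
  ring

/-! ### The duality pairing of `L^p` -/

section LpGeometry

variable {α : Type*} [MeasurableSpace α] {ν : Measure α} {p : ℝ≥0∞}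

theorem one_lt_toReal {p : ℝ≥0∞} (hp : 1 < p) (hp' : p < ⊤) : 1 < p.toReal := by
  simpa using (ENNReal.toReal_lt_toReal ENNReal.one_ne_top hp'.ne).2 hp

theorem Lp_norm_rpow [Fact (1 ≤ p)] (hp : 1 < p) (hp' : p < ⊤) (u : Lp ℂ p ν) :
    ‖u‖ ^ p.toReal = ∫ x, ‖u x‖ ^ p.toReal ∂ν := by
  have h1 := one_lt_toReal hp hp'
  rw [Lp.norm_def, toReal_eLpNorm (Lp.aestronglyMeasurable u),
    lpNorm_eq_integral_norm_rpow_toReal (by positivity) hp'.ne (Lp.aestronglyMeasurable u),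
    ← Real.rpow_mul (integral_nonneg fun x => by positivity), inv_mul_cancel₀ (by linarith),
    Real.rpow_one]

theorem integrable_norm_rpow_Lp (hp : 1 < p) (hp' : p < ⊤) (u : Lp ℂ p ν) :
    Integrable (fun x => ‖u x‖ ^ p.toReal) ν :=
  (Lp.memLp u).integrable_norm_rpow (by positivity) hp'.ne

theorem rpow_sub_one_mul_le {r a b : ℝ} (hr : 1 < r) (ha : 0 ≤ a) (hb : 0 ≤ b) :
    a ^ (r - 1) * b ≤ a ^ r + b ^ r := by
  have key : ∀ c : ℝ, 0 ≤ c → c ^ (r - 1) * c = c ^ r := fun c hc => by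
    rcases hc.eq_or_lt with rfl | hc
    · simp [Real.zero_rpow (by linarith : r ≠ 0)]
    · rw [← Real.rpow_add_one hc.ne']; ring_nf
  have h1 : 0 ≤ a ^ r := Real.rpow_nonneg ha _
  have h2 : 0 ≤ b ^ r := Real.rpow_nonneg hb _
  rcases le_total a b with h | h
  · calc a ^ (r - 1) * b ≤ b ^ (r - 1) * b := by gcongr
      _ ≤ a ^ r + b ^ r := by rw [key b hb]; linarith
  · calc a ^ (r - 1) * b ≤ a ^ (r - 1) * a := by gcongr
      _ ≤ a ^ r + b ^ r := by rw [key a ha]; linarith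

/-- The pairing `∫ f |u|^{p-2} ū`. -/
def dualPair (u f : Lp ℂ p ν) : ℂ := ∫ x, starRingEnd ℂ (powerMap p.toReal (u x)) * f x ∂ν

theorem norm_conj_powerMap_mul {r : ℝ} (hr : 1 < r) (z w : ℂ) :
    ‖starRingEnd ℂ (powerMap r z) * w‖ = ‖z‖ ^ (r - 1) * ‖w‖ := by
  rw [norm_mul, RCLike.norm_conj, norm_powerMap hr]

theorem aestronglyMeasurable_dualPair (hp : 1 < p) (hp' : p < ⊤) {u f : α → ℂ}
    (hu : AEStronglyMeasurable u ν) (hf : AEStronglyMeasurable f ν) :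
    AEStronglyMeasurable (fun x => starRingEnd ℂ (powerMap p.toReal (u x)) * f x) ν :=
  ((Complex.continuous_conj.comp
    (continuous_powerMap (one_lt_toReal hp hp'))).comp_aestronglyMeasurable hu).mul hf

theorem integrable_dualPair (hp : 1 < p) (hp' : p < ⊤) (u f : Lp ℂ p ν) :
    Integrable (fun x => starRingEnd ℂ (powerMap p.toReal (u x)) * f x) ν := by
  have h1 := one_lt_toReal hp hp'
  refine ((integrable_norm_rpow_Lp hp hp' u).add (integrable_norm_rpow_Lp hp hp' f)).mono'
    (aestronglyMeasurable_dualPair hp hp' (Lp.aestronglyMeasurable u) (Lp.aestronglyMeasurable f))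
    (Eventually.of_forall fun x => ?_)
  rw [norm_conj_powerMap_mul h1]
  exact rpow_sub_one_mul_le h1 (norm_nonneg _) (norm_nonneg _)

theorem dualPair_self [Fact (1 ≤ p)] (hp : 1 < p) (hp' : p < ⊤) (u : Lp ℂ p ν) :
    dualPair u u = ((‖u‖ ^ p.toReal : ℝ) : ℂ) := by
  rw [Lp_norm_rpow hp hp', dualPair, ← integral_complex_ofReal]
  simp only [conj_powerMap_mul_self (one_lt_toReal hp hp')]

theorem dualPair_add_smul (hp : 1 < p) (hp' : p < ⊤) (u f g : Lp ℂ p ν) (c : ℂ) :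
    dualPair u (f + c • g) = dualPair u f + c * dualPair u g := by
  rw [dualPair, dualPair, dualPair, ← integral_const_mul, ← integral_add
    (integrable_dualPair hp hp' u f) ((integrable_dualPair hp hp' u g).const_mul c)]
  refine integral_congr_ae ?_
  filter_upwards [Lp.coeFn_add f (c • g), Lp.coeFn_smul c g] with x h1 h2
  rw [h1, Pi.add_apply, h2, Pi.smul_apply, smul_eq_mul]
  ring

theorem norm_dualPair_le [Fact (1 ≤ p)] (hp : 1 < p) (hp' : p < ⊤) (u f : Lp ℂ p ν) :
    ‖dualPair u f‖ ≤ ‖u‖ ^ (p.toReal - 1) * ‖f‖ := by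
  have h1 := one_lt_toReal hp hp'
  set r := p.toReal with hr
  have hconj : r.HolderConjugate r.conjExponent := Real.HolderConjugate.conjExponent h1
  have hq0 : 0 < r.conjExponent := hconj.symm.pos
  have hpr : p = ENNReal.ofReal r := (ENNReal.ofReal_toReal hp'.ne).symm
  have hgm : AEStronglyMeasurable (fun x => powerMap r (u x)) ν :=
    (continuous_powerMap h1).comp_aestronglyMeasurable (Lp.aestronglyMeasurable u)
  have hpow : ∀ x, ‖powerMap r (u x)‖ ^ r.conjExponent = ‖u x‖ ^ r := fun x => by
    rw [norm_powerMap h1, ← Real.rpow_mul (norm_nonneg _), hconj.sub_one_mul_conj]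
  have hg : MemLp (fun x => powerMap r (u x)) (ENNReal.ofReal r.conjExponent) ν := by
    rw [← integrable_norm_rpow_iff hgm (by simpa using hq0) ENNReal.ofReal_ne_top,
      ENNReal.toReal_ofReal hq0.le]
    simp only [hpow]
    exact integrable_norm_rpow_Lp hp hp' u
  have hf : MemLp f (ENNReal.ofReal r) ν := hpr ▸ Lp.memLp f
  have h := integral_mul_norm_le_Lp_mul_Lq hconj hf hg
  simp only [hpow] at h
  rw [← Lp_norm_rpow hp hp', ← Lp_norm_rpow hp hp', ← Real.rpow_mul (norm_nonneg _),
    ← Real.rpow_mul (norm_nonneg _), mul_one_div_cancel hconj.ne_zero, Real.rpow_one,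
    mul_comm] at h
  have he : r * (1 / r.conjExponent) = r - 1 := by
    rw [Real.conjExponent]; field_simp
  rw [← hr, he] at h
  refine (norm_integral_le_integral_norm _).trans (le_trans (le_of_eq ?_) h)
  refine integral_congr_ae (Eventually.of_forall fun x => ?_)
  simp only [norm_mul, RCLike.norm_conj, ← hr, mul_comm]

theorem tendsto_dualPair [Fact (1 ≤ p)] (hp : 1 < p) (hp' : p < ⊤) (u h f : Lp ℂ p ν) :
    Tendsto (fun n : ℕ => dualPair (u + ((1 / ((n : ℝ) + 1) : ℝ) : ℂ) • h) f) atTop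
      (𝓝 (dualPair u f)) := by
  have h1 := one_lt_toReal hp hp'
  have hS : MemLp (fun x => ‖u x‖ + ‖h x‖) p ν := (Lp.memLp u).norm.add (Lp.memLp h).norm
  have hSi := (hS.integrable_norm_rpow (by positivity) hp'.ne).add (integrable_norm_rpow_Lp hp hp' f)
  have hcoe : ∀ n : ℕ, ∀ᵐ x ∂ν, (u + ((1 / ((n : ℝ) + 1) : ℝ) : ℂ) • h : Lp ℂ p ν) x =
      u x + ((1 / ((n : ℝ) + 1) : ℝ) : ℂ) * h x := fun n => by
    filter_upwards [Lp.coeFn_add u (((1 / ((n : ℝ) + 1) : ℝ) : ℂ) • h),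
      Lp.coeFn_smul ((1 / ((n : ℝ) + 1) : ℝ) : ℂ) h] with x h1 h2
    rw [h1, Pi.add_apply, h2, Pi.smul_apply, smul_eq_mul]
  refine tendsto_integral_of_dominated_convergence _
    (fun n => aestronglyMeasurable_dualPair hp hp' (Lp.aestronglyMeasurable _)
      (Lp.aestronglyMeasurable f)) hSi (fun n => ?_) ?_
  · filter_upwards [hcoe n] with x hx
    rw [norm_conj_powerMap_mul h1, hx]
    refine le_trans ?_ (rpow_sub_one_mul_le h1 (norm_nonneg _) (norm_nonneg _))
    refine mul_le_mul_of_nonneg_right (Real.rpow_le_rpow (norm_nonneg _) ?_ (by linarith))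
      (norm_nonneg _)
    rw [Real.norm_of_nonneg (by positivity)]
    refine (norm_add_le _ _).trans (add_le_add le_rfl ?_)
    rw [norm_mul, Complex.norm_real, Real.norm_of_nonneg (by positivity)]
    refine mul_le_of_le_one_left (norm_nonneg _) ?_
    rw [div_le_one (by positivity)]
    linarith [n.cast_nonneg (α := ℝ)]
  · filter_upwards [ae_all_iff.2 hcoe] with x hx
    simp only [hx]
    have ht : Tendsto (fun n : ℕ => ((1 / ((n : ℝ) + 1) : ℝ) : ℂ)) atTop (𝓝 0) := by
      have := (Complex.continuous_ofReal.tendsto 0).comp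
        (tendsto_one_div_add_atTop_nhds_zero_nat (𝕜 := ℝ))
      simpa [Function.comp_def] using this
    have h2 : Tendsto (fun n : ℕ => u x + ((1 / ((n : ℝ) + 1) : ℝ) : ℂ) * h x) atTop
        (𝓝 (u x)) := by simpa using (ht.mul_const (h x)).const_add (u x)
    exact (((Complex.continuous_conj.comp (continuous_powerMap h1)).tendsto (u x)).comp h2).mul_const
      (f x)

theorem norm_le_norm_add_smul [Fact (1 ≤ p)] (hp : 1 < p) (hp' : p < ⊤) {v g : Lp ℂ p ν} {c : ℂ}
    (h : 0 ≤ (c * dualPair v g).re) {t : ℝ} (ht : 0 ≤ t) : ‖v‖ ≤ ‖v + ((t : ℂ) * c) • g‖ := by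
  have h1 := one_lt_toReal hp hp'
  rcases (norm_nonneg v).eq_or_lt with h0 | h0
  · rw [← h0]; exact norm_nonneg _
  have h2 := (Complex.re_le_norm _).trans (norm_dualPair_le hp hp' v (v + ((t : ℂ) * c) • g))
  rw [dualPair_add_smul hp hp', dualPair_self hp hp', Complex.add_re, Complex.ofReal_re, mul_assoc,
    Complex.re_ofReal_mul] at h2
  have h3 : ‖v‖ ^ p.toReal = ‖v‖ ^ (p.toReal - 1) * ‖v‖ := by
    rw [← Real.rpow_add_one h0.ne']; ring_nf
  have h4 : ‖v‖ ^ (p.toReal - 1) * ‖v‖ ≤ ‖v‖ ^ (p.toReal - 1) * ‖v + ((t : ℂ) * c) • g‖ := by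
    linarith [mul_nonneg ht h]
  exact le_of_mul_le_mul_left h4 (by positivity)

/-- Testing `w = u + t h` against its own duality functional. -/
theorem rpow_mul_sub_le_dualPair [Fact (1 ≤ p)] (hp : 1 < p) (hp' : p < ⊤) {u : Lp ℂ p ν}
    (hu : ‖u‖ = 1) (h : Lp ℂ p ν) (t : ℝ) (hw : 0 < ‖u + (t : ℂ) • h‖) :
    ‖u + (t : ℂ) • h‖ ^ (p.toReal - 1) * (‖u + (t : ℂ) • h‖ - 1) ≤
      t * (dualPair (u + (t : ℂ) • h) h).re := by
  set w := u + (t : ℂ) • h with hwdef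
  have h1 := dualPair_add_smul hp hp' w u h t
  rw [← hwdef, dualPair_self hp hp'] at h1
  have h2 := congrArg Complex.re h1
  rw [Complex.ofReal_re, Complex.add_re, Complex.re_ofReal_mul] at h2
  have h3 := (Complex.re_le_norm _).trans (norm_dualPair_le hp hp' w u)
  have h4 : ‖w‖ ^ p.toReal = ‖w‖ ^ (p.toReal - 1) * ‖w‖ := by
    rw [← Real.rpow_add_one hw.ne']; ring_nf
  rw [hu] at h3
  linarith

/-- The norm of `L^p` is smooth: a direction in which the norm does not decrease from a unit vector
is not decreasing for any norming functional of that vector. -/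
theorem re_dualityMap_nonneg [Fact (1 ≤ p)] (hp : 1 < p) (hp' : p < ⊤) {u h : Lp ℂ p ν}
    (hu : ‖u‖ = 1) (hh : ∀ t : ℝ, 0 < t → 1 ≤ ‖u + (t : ℂ) • h‖)
    {φ : StrongDual ℂ (Lp ℂ p ν)} (hφ : φ ∈ dualityMap u) : 0 ≤ (φ h).re := by
  have hpos : ∀ n : ℕ, (0 : ℝ) < 1 / ((n : ℝ) + 1) := fun n => by positivity
  have ht0 : Tendsto (fun n : ℕ => (1 / ((n : ℝ) + 1) : ℝ)) atTop (𝓝 0) :=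
    tendsto_one_div_add_atTop_nhds_zero_nat
  have ha : 0 ≤ (dualPair u h).re := by
    refine ge_of_tendsto ((Complex.continuous_re.tendsto _).comp (tendsto_dualPair hp hp' u h h))
      (Eventually.of_forall fun n => ?_)
    have h1 := hh _ (hpos n)
    have h2 := rpow_mul_sub_le_dualPair hp hp' hu h _ (one_pos.trans_le h1)
    have h3 := (mul_nonneg (Real.rpow_nonneg (norm_nonneg _) _) (sub_nonneg.2 h1)).trans h2
    exact nonneg_of_mul_nonneg_right h3 (hpos n)
  have hb : (φ (-h)).re ≤ (dualPair u (-h)).re := by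
    have hw : Tendsto (fun n : ℕ => ‖u + ((1 / ((n : ℝ) + 1) : ℝ) : ℂ) • (-h)‖) atTop (𝓝 1) := by
      have h1 := (((Complex.continuous_ofReal.tendsto 0).comp ht0).smul_const (-h)).const_add u
      simpa [hu] using h1.norm
    have hl : Tendsto (fun n : ℕ => ‖u + ((1 / ((n : ℝ) + 1) : ℝ) : ℂ) • (-h)‖ ^ (p.toReal - 1) *
        (φ (-h)).re) atTop (𝓝 (φ (-h)).re) := by
      simpa using (hw.rpow_const (p := p.toReal - 1) (Or.inl one_ne_zero)).mul_const (φ (-h)).re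
    refine le_of_tendsto_of_tendsto hl
      ((Complex.continuous_re.tendsto _).comp (tendsto_dualPair hp hp' u (-h) (-h))) ?_
    filter_upwards [hw.eventually (lt_mem_nhds one_pos)] with n hn
    have h2 := rpow_mul_sub_le_dualPair hp hp' hu (-h) _ hn
    have h3 : 1 + 1 / ((n : ℝ) + 1) * (φ (-h)).re ≤
        ‖u + ((1 / ((n : ℝ) + 1) : ℝ) : ℂ) • (-h)‖ := by
      have h4 := (Complex.re_le_norm _).trans (φ.le_opNorm (u + ((1 / ((n : ℝ) + 1) : ℝ) : ℂ) • (-h)))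
      rw [hφ.2, one_mul, map_add, map_smul, hφ.1, hu, smul_eq_mul, Complex.add_re,
        Complex.re_ofReal_mul] at h4
      simpa using h4
    have h5 := mul_le_mul_of_nonneg_left (sub_le_sub_right h3 1)
      (Real.rpow_nonneg hn.le (p.toReal - 1))
    refine le_of_mul_le_mul_left ?_ (hpos n)
    simp only [Function.comp_apply]
    linarith
  have hneg : dualPair u (-h) = - dualPair u h := by
    have := dualPair_add_smul hp hp' u 0 h (-1)
    have h0 : dualPair u (0 : Lp ℂ p ν) = 0 := by
      have := norm_dualPair_le hp hp' u 0
      simpa using this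
    simpa [h0] using this
  rw [hneg, map_neg, Complex.neg_re, Complex.neg_re] at hb
  linarith

end LpGeometry

/-! ### Orbit integrals of strongly continuous semigroups -/

section Semigroup

variable {X : Type*} [NormedAddCommGroup X] [NormedSpace ℂ X]
variable {Y : Type*} [NormedAddCommGroup Y] [NormedSpace ℂ Y]

/-- The integral `∫_0^h T(s) f ds`. -/
def orbitIntegral (T : ℝ≥0 → X →L[ℂ] X) (h : ℝ≥0) (f : X) : X :=
  ∫ s in (0 : ℝ)..h, T s.toNNReal f

theorem IsC0Semigroup.continuous_toNNReal {T : ℝ≥0 → X →L[ℂ] X} (hT : IsC0Semigroup T) (f : X) :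
    Continuous fun s : ℝ => T s.toNNReal f :=
  (hT.continuous f).comp continuous_real_toNNReal

theorem ofReal_inv_smul_eq (t : ℝ) (x : X) : ((t : ℂ))⁻¹ • x = t⁻¹ • x := by
  rw [← Complex.ofReal_inv, Complex.coe_smul]

theorem tendsto_coe_nhdsGT_zero :
    Tendsto (fun t : ℝ≥0 => (t : ℝ)) (𝓝[>] 0) (𝓝[≠] 0) := by
  refine tendsto_nhdsWithin_iff.2 ⟨?_, ?_⟩
  · exact (NNReal.continuous_coe.tendsto 0).mono_left nhdsWithin_le_nhds
  · filter_upwards [self_mem_nhdsWithin] with t ht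
    exact (NNReal.coe_pos.2 ht).ne'

theorem tendsto_inv_smul_integral [CompleteSpace X] {F : ℝ → X} (hF : Continuous F) (a : ℝ) :
    Tendsto (fun t : ℝ≥0 => (((t : ℝ) : ℂ))⁻¹ • ∫ s in a..(a + t), F s) (𝓝[>] 0) (𝓝 (F a)) := by
  have h1 := (hasDerivAt_iff_tendsto_slope_zero.1 (hF.integral_hasStrictDerivAt a a).hasDerivAt).comp
    tendsto_coe_nhdsGT_zero
  refine h1.congr fun t => ?_
  simp [ofReal_inv_smul_eq]

theorem tendsto_inv_smul_orbitIntegral [CompleteSpace X] {T : ℝ≥0 → X →L[ℂ] X}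
    (hT : IsC0Semigroup T) (u : X) :
    Tendsto (fun t : ℝ≥0 => (((t : ℝ) : ℂ))⁻¹ • orbitIntegral T t u) (𝓝[>] 0) (𝓝 u) := by
  have h := tendsto_inv_smul_integral (hT.continuous_toNNReal u) 0
  simpa [orbitIntegral, hT.map_zero] using h

theorem orbitIntegral_mem_negGenerator [CompleteSpace X] {T : ℝ≥0 → X →L[ℂ] X}
    (hT : IsC0Semigroup T) (h : ℝ≥0) (f : X) :
    (orbitIntegral T h f, f - T h f) ∈ negGenerator T := by
  have hc := hT.continuous_toNNReal f
  have h0 := tendsto_inv_smul_integral hc 0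
  have h1 := tendsto_inv_smul_integral hc h
  have h2 := h0.sub h1
  simp only [Real.toNNReal_zero, Real.toNNReal_coe, hT.map_zero, ContinuousLinearMap.id_apply,
    zero_add] at h2
  refine h2.congr fun t => ?_
  have hTt : T t (orbitIntegral T h f) = ∫ s in (t : ℝ)..(h + t), T s.toNNReal f := by
    rw [orbitIntegral, ← ContinuousLinearMap.intervalIntegral_comp_comm _
      (hc.intervalIntegrable _ _)]
    have := intervalIntegral.integral_comp_add_right (fun s : ℝ => T s.toNNReal f) (t : ℝ)
      (a := 0) (b := h)
    rw [zero_add] at this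
    rw [← this]
    refine intervalIntegral.integral_congr fun s hs => ?_
    rw [Set.uIcc_of_le h.coe_nonneg] at hs
    rw [Real.toNNReal_add hs.1 t.coe_nonneg, Real.toNNReal_coe, add_comm, hT.map_add]
    rfl
  rw [← smul_sub, hTt, orbitIntegral, intervalIntegral.integral_interval_sub_interval_comm
    (hc.intervalIntegrable _ _) (hc.intervalIntegrable _ _) (hc.intervalIntegrable _ _)]

theorem map_orbitIntegral [CompleteSpace X] [CompleteSpace Y] {Q : Type*} [NormedAddCommGroup Q]
    [NormedSpace ℂ Q] [CompleteSpace Q] {T : ℝ≥0 → X →L[ℂ] X} {S : ℝ≥0 → Y →L[ℂ] Y}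
    (hT : IsC0Semigroup T) (hS : IsC0Semigroup S) (a : X →L[ℂ] Q) (b : Y →L[ℂ] Q)
    {f : X} {g : Y} (hfg : ∀ t, a (T t f) = b (S t g)) (h : ℝ≥0) :
    a (orbitIntegral T h f) = b (orbitIntegral S h g) := by
  rw [orbitIntegral, orbitIntegral,
    ← ContinuousLinearMap.intervalIntegral_comp_comm a
      ((hT.continuous_toNNReal f).intervalIntegrable _ _),
    ← ContinuousLinearMap.intervalIntegral_comp_comm b
      ((hS.continuous_toNNReal g).intervalIntegrable _ _)]
  exact intervalIntegral.integral_congr fun s _ => hfg _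

/-- Orbit integrals of a pair of semigroups stay in a closed subspace left invariant by the pair. -/
theorem orbitIntegral_mem_of_isClosed [CompleteSpace X] [CompleteSpace Y]
    {T : ℝ≥0 → X →L[ℂ] X} {S : ℝ≥0 → Y →L[ℂ] Y} (hT : IsC0Semigroup T) (hS : IsC0Semigroup S)
    (K : Submodule ℂ (X × Y)) (hK : IsClosed (K : Set (X × Y))) {f : X} {g : Y}
    (hfg : ∀ t, (T t f, S t g) ∈ K) (h : ℝ≥0) :
    (orbitIntegral T h f, orbitIntegral S h g) ∈ K := by
  have : IsClosed (K : Set (X × Y)) := hK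
  let a : X →L[ℂ] (X × Y) ⧸ K := K.mkQL.comp (ContinuousLinearMap.inl ℂ X Y)
  let b : Y →L[ℂ] (X × Y) ⧸ K := -K.mkQL.comp (ContinuousLinearMap.inr ℂ X Y)
  have key : ∀ (x : X) (y : Y), a x = b y ↔ (x, y) ∈ K := fun x y => by
    rw [← sub_eq_zero]
    have e : a x - b y = K.mkQ (x, y) := by
      have e1 : ((x, y) : X × Y) = (x, 0) + (0, y) := by simp
      rw [e1, map_add]
      simp [a, b]
    rw [e]
    simp
  rw [← key]
  exact map_orbitIntegral hT hS a b (fun t => (key _ _).2 (hfg t)) h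

theorem continuous_orbitIntegral [CompleteSpace X] {T : ℝ≥0 → X →L[ℂ] X}
    (hT : IsC0Semigroup T) (h : ℝ≥0) : Continuous (orbitIntegral T h) := by
  obtain ⟨C, hC⟩ := banach_steinhaus (g := fun s : Set.Icc (0 : ℝ) h => T (s : ℝ).toNNReal)
    fun x => by
      obtain ⟨C, hC⟩ := isCompact_Icc.exists_bound_of_continuousOn
        (hT.continuous_toNNReal x).continuousOn (s := Set.Icc (0 : ℝ) h)
      exact ⟨C, fun s => hC s s.2⟩
  have hC0 : 0 ≤ C := (norm_nonneg _).trans (hC ⟨0, le_rfl, h.coe_nonneg⟩)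
  refine LipschitzWith.continuous (K := C.toNNReal * h) (LipschitzWith.of_dist_le_mul
    fun x y => ?_)
  rw [dist_eq_norm, dist_eq_norm, orbitIntegral, orbitIntegral, ← intervalIntegral.integral_sub
    ((hT.continuous_toNNReal x).intervalIntegrable _ _)
    ((hT.continuous_toNNReal y).intervalIntegrable _ _)]
  refine (intervalIntegral.norm_integral_le_of_norm_le_const (C := C * ‖x - y‖)
    fun s hs => ?_).trans (le_of_eq ?_)
  · rw [Set.uIoc_of_le h.coe_nonneg] at hs
    rw [← map_sub]
    exact (T s.toNNReal).le_of_opNorm_le (hC ⟨s, hs.1.le, hs.2⟩) _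
  · rw [sub_zero, abs_of_nonneg h.coe_nonneg]
    rw [NNReal.coe_mul, Real.coe_toNNReal C hC0]
    ring

/-- A lower bound for `1 + c B`, where `-B` is the generator, follows from the same bound on the
orbit integrals of a dense set. -/
theorem norm_le_of_dense_orbitIntegral [CompleteSpace X] {T : ℝ≥0 → X →L[ℂ] X}
    (hT : IsC0Semigroup T) {S : Set X} (hS : Dense S) {c : ℂ}
    (hc : ∀ g ∈ S, ∀ h : ℝ≥0, ‖orbitIntegral T h g‖ ≤ ‖orbitIntegral T h g + c • (g - T h g)‖)
    {u f : X} (huf : (u, f) ∈ negGenerator T) : ‖u‖ ≤ ‖u + c • f‖ := by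
  have hall : ∀ (h : ℝ≥0) (g : X),
      ‖orbitIntegral T h g‖ ≤ ‖orbitIntegral T h g + c • (g - T h g)‖ := fun h g => by
    have hco := continuous_orbitIntegral hT h
    have hcl : IsClosed {g : X | ‖orbitIntegral T h g‖ ≤
        ‖orbitIntegral T h g + c • (g - T h g)‖} :=
      isClosed_le hco.norm (hco.add ((continuous_id.sub (T h).continuous).const_smul c)).norm
    exact hcl.closure_subset_iff.2 (fun g hg => hc g hg h) (hS g)
  have h1 := tendsto_inv_smul_orbitIntegral hT u
  have h2 := h1.add (Tendsto.const_smul huf c)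
  refine le_of_tendsto_of_tendsto' h1.norm h2.norm fun t => ?_
  rw [smul_comm c, ← smul_add, norm_smul, norm_smul]
  exact mul_le_mul_of_nonneg_left (hall t u) (norm_nonneg _)

end Semigroup

section WeakGradient

open scoped Convolution

/-! ### Mollification and the chain rule for weak gradients -/

/-- If `f n → f` almost everywhere and the `L¹`-norms of `f n` do not exceed that of `f`, then
`f n → f` in `L¹`. -/
theorem tendsto_integral_norm_sub_of_ae {α E : Type*} [MeasurableSpace α] [NormedAddCommGroup E]
    {ν : Measure α} {F : ℕ → α → E} {f : α → E} (hF : ∀ n, Integrable (F n) ν)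
    (hf : Integrable f ν) (hlim : ∀ᵐ x ∂ν, Tendsto (fun n => F n x) atTop (𝓝 (f x)))
    (hle : ∀ n, ∫ x, ‖F n x‖ ∂ν ≤ ∫ x, ‖f x‖ ∂ν) :
    Tendsto (fun n => ∫ x, ‖F n x - f x‖ ∂ν) atTop (𝓝 0) := by
  have h1 : Tendsto (fun n => ∫ x, (‖F n x - f x‖ - ‖F n x‖ + ‖f x‖) ∂ν) atTop
      (𝓝 (∫ _, (0 : ℝ) ∂ν)) := by
    refine tendsto_integral_of_dominated_convergence (fun x => 2 * ‖f x‖)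
      (fun n => ((((hF n).sub hf).norm.sub (hF n).norm).add hf.norm).aestronglyMeasurable)
      (hf.norm.const_mul 2) (fun n => Eventually.of_forall fun x => ?_) ?_
    · have a := norm_sub_le (F n x) (f x)
      have b := norm_sub_norm_le (F n x) (f x)
      rw [Real.norm_eq_abs, abs_le]
      constructor <;> linarith
    · filter_upwards [hlim] with x hx
      have := ((hx.sub_const (f x)).norm.sub hx.norm).add_const ‖f x‖
      simpa using this
  rw [integral_zero] at h1
  refine squeeze_zero (fun n => integral_nonneg fun x => norm_nonneg _) (fun n => ?_) h1
  have hs : Integrable (fun x => ‖F n x - f x‖) ν := ((hF n).sub hf).norm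
  have hs' : Integrable (fun x => ‖F n x - f x‖ - ‖F n x‖) ν := hs.sub (hF n).norm
  rw [integral_add hs' hf.norm, integral_sub hs (hF n).norm]
  linarith [hle n]

section Mollify

variable {d : ℕ}

/-- The mollification of `f` by a normalized bump function. -/
def mollify (b : ContDiffBump (0 : Rd d)) (f : Rd d → ℂ) : Rd d → ℂ :=
  b.normed volume ⋆[ContinuousLinearMap.lsmul ℝ ℝ, volume] f

theorem integrable_mollify (b : ContDiffBump (0 : Rd d)) {f : Rd d → ℂ} (hf : Integrable f) :
    Integrable (mollify b f) :=
  b.integrable_normed.integrable_convolution _ hf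

theorem integral_norm_mollify_le (b : ContDiffBump (0 : Rd d)) {f : Rd d → ℂ}
    (hf : Integrable f) : ∫ x, ‖mollify b f x‖ ≤ ∫ x, ‖f x‖ := by
  have h := integral_convolution (μ := volume) (ν := volume) (ContinuousLinearMap.lsmul ℝ ℝ)
    (b.integrable_normed (μ := volume)) hf.norm
  rw [b.integral_normed] at h
  simp only [ContinuousLinearMap.lsmul_apply, one_smul] at h
  rw [← h]
  refine integral_mono (integrable_mollify b hf).norm
    (b.integrable_normed.integrable_convolution _ hf.norm) fun x => ?_
  refine (norm_integral_le_integral_norm _).trans (le_of_eq ?_)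
  refine integral_congr_ae (Eventually.of_forall fun t => ?_)
  simp [abs_of_nonneg (b.nonneg_normed (μ := volume) t)]

theorem contDiff_mollify (b : ContDiffBump (0 : Rd d)) {f : Rd d → ℂ} (hf : Integrable f) :
    ContDiff ℝ ∞ (mollify b f) :=
  b.hasCompactSupport_normed.contDiff_convolution_left _ b.contDiff_normed hf.locallyIntegrable

theorem mollify_apply (b : ContDiffBump (0 : Rd d)) (f : Rd d → ℂ) (x : Rd d) :
    mollify b f x = ∫ y, b.normed volume (x - y) • f y := by
  simp [mollify, convolution_eq_swap]

theorem fderiv_mollify_apply (b : ContDiffBump (0 : Rd d)) {f : Rd d → ℂ} (hf : Integrable f)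
    (x v : Rd d) :
    fderiv ℝ (mollify b f) x v = ∫ y, (fderiv ℝ (b.normed volume) (x - y) v) • f y := by
  have h := (b.hasCompactSupport_normed (μ := volume)).hasFDerivAt_convolution_left
    (ContinuousLinearMap.lsmul ℝ ℝ) b.contDiff_normed (g := f) (μ := volume)
      hf.locallyIntegrable x
  rw [show fderiv ℝ (mollify b f) x = _ from h.fderiv]
  have hint := ((b.hasCompactSupport_normed (μ := volume)).fderiv ℝ).convolutionExists_left
    (ContinuousLinearMap.precompL (Rd d) (ContinuousLinearMap.lsmul ℝ ℝ)) (μ := volume)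
    ((b.contDiff_normed (n := 1)).continuous_fderiv one_ne_zero) hf.locallyIntegrable x
  rw [convolution_eq_swap, ContinuousLinearMap.integral_apply hint.integrable_swap]
  simp

/-- Mollification commutes with weak derivatives, away from the boundary. -/
theorem fderiv_mollify_of_isWeakGradient {Ω : Set (Rd d)} (hΩ : MeasurableSet Ω)
    {u : Rd d → ℂ} {g : Rd d → Cd d} (hg : IsWeakGradient Ω u g) (hu : IntegrableOn u Ω)
    (b : ContDiffBump (0 : Rd d)) {x : Rd d} (hx : Metric.closedBall x b.rOut ⊆ Ω) (i : Fin d) :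
    fderiv ℝ (mollify b (Ω.indicator u)) x (EuclideanSpace.single i 1) =
      mollify b (Ω.indicator fun y => g y i) x := by
  rw [fderiv_mollify_apply b ((integrable_indicator_iff hΩ).2 hu), mollify_apply]
  have hs : ∀ (c : Rd d → ℝ) (f : Rd d → ℂ),
      ∫ y, c y • Ω.indicator f y = ∫ y in Ω, c y • f y := fun c f => by
    rw [← integral_indicator hΩ]
    congr 1; ext y
    by_cases hy : y ∈ Ω <;> simp [hy]
  rw [hs (fun y => fderiv ℝ (b.normed volume) (x - y) (EuclideanSpace.single i 1)) u,
    hs (fun y => b.normed volume (x - y))]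
  have hsub : ContDiff ℝ ∞ fun y : Rd d => x - y := contDiff_const.sub contDiff_id
  have hc : ContDiff ℝ ∞ fun y => b.normed volume (x - y) := b.contDiff_normed.comp hsub
  have hsup : tsupport (fun y => b.normed volume (x - y)) ⊆ Metric.closedBall x b.rOut := by
    refine closure_minimal (fun y hy => ?_) Metric.isClosed_closedBall
    have : x - y ∈ Function.support (b.normed volume) := hy
    rw [b.support_normed_eq] at this
    rw [Metric.mem_closedBall, dist_comm, dist_eq_norm]
    exact (mem_ball_zero_iff.1 this).le
  have h := hg _ hc (HasCompactSupport.of_support_subset_isCompact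
    (isCompact_closedBall x b.rOut) (subset_closure.trans hsup)) (hsup.trans hx) i
  have hd : ∀ y, fderiv ℝ (fun y => b.normed volume (x - y)) y (EuclideanSpace.single i 1) =
      - fderiv ℝ (b.normed volume) (x - y) (EuclideanSpace.single i 1) := fun y => by
    have h1 : HasFDerivAt (b.normed volume) (fderiv ℝ (b.normed volume) (x - y)) (x - y) :=
      ((b.contDiff_normed (n := 1)).differentiable one_ne_zero _).hasFDerivAt
    have h2 := h1.comp y ((hasFDerivAt_id y).const_sub x)
    have h3 : fderiv ℝ (fun y => b.normed volume (x - y)) y = _ := h2.fderiv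
    rw [h3]; simp
  simp only [hd, neg_smul, integral_neg, neg_inj] at h
  exact h

theorem tendsto_integral_of_norm_sub_le {α E : Type*} [MeasurableSpace α] [NormedAddCommGroup E]
    [NormedSpace ℝ E] {ν : Measure α} {F : ℕ → α → E} {f : α → E} {B : ℕ → α → ℝ}
    (hF : ∀ n, Integrable (F n) ν) (hf : Integrable f ν) (hB : ∀ n, Integrable (B n) ν)
    (hle : ∀ n x, ‖F n x - f x‖ ≤ B n x)
    (hlim : Tendsto (fun n => ∫ x, B n x ∂ν) atTop (𝓝 0)) :
    Tendsto (fun n => ∫ x, F n x ∂ν) atTop (𝓝 (∫ x, f x ∂ν)) := by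
  rw [tendsto_iff_norm_sub_tendsto_zero]
  refine squeeze_zero (fun n => norm_nonneg _) (fun n => ?_) hlim
  rw [← integral_sub (hF n) hf]
  exact norm_integral_le_of_norm_le (hB n) (Eventually.of_forall (hle n))

theorem norm_sub_le_of_fderiv {Φ : ℂ → ℂ} (hΦ : ContDiff ℝ 1 Φ) {C : ℝ}
    (hC : ∀ z, ‖fderiv ℝ Φ z‖ ≤ C) (z w : ℂ) : ‖Φ z - Φ w‖ ≤ C * ‖z - w‖ :=
  convex_univ.norm_image_sub_le_of_norm_fderiv_le
    (fun x _ => hΦ.differentiable one_ne_zero x) (fun x _ => hC x) (Set.mem_univ _) (Set.mem_univ _)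

/-- The chain rule for integrable functions with integrable weak gradient. -/
theorem IsWeakGradient.comp_of_integrableOn {Ω : Set (Rd d)} (hΩ : IsOpen Ω)
    {u : Rd d → ℂ} {g : Rd d → Cd d} (hg : IsWeakGradient Ω u g) (hu : IntegrableOn u Ω)
    (hgi : ∀ i, IntegrableOn (fun x => g x i) Ω)
    {Φ : ℂ → ℂ} (hΦ : ContDiff ℝ 1 Φ) (hΦ0 : Φ 0 = 0) {C : ℝ} (hC : ∀ z, ‖fderiv ℝ Φ z‖ ≤ C) :
    IsWeakGradient Ω (fun x => Φ (u x))
      (fun x => WithLp.toLp 2 fun i => fderiv ℝ Φ (u x) (g x i)) := by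
  intro η hη hηc hηs i
  set v : Rd d := EuclideanSpace.single i 1
  set U := Ω.indicator u with hU
  set G := Ω.indicator (fun x => g x i) with hG
  have hUi : Integrable U := (integrable_indicator_iff hΩ.measurableSet).2 hu
  have hGi : Integrable G := (integrable_indicator_iff hΩ.measurableSet).2 (hgi i)
  have hC0 : 0 ≤ C := (norm_nonneg _).trans (hC 0)
  obtain ⟨δ, hδ, hδs⟩ := hηc.isCompact.exists_cthickening_subset_open hΩ hηs
  let r : ℕ → ℝ := fun n => δ / 2 * (1 / ((n : ℝ) + 1))
  have hr : ∀ n, 0 < r n := fun n => by positivity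
  let b : ℕ → ContDiffBump (0 : Rd d) := fun n => ⟨r n, 2 * r n, hr n, by linarith [hr n]⟩
  have hb0 : Tendsto (fun n => (b n).rOut) atTop (𝓝 0) := by
    have := (tendsto_one_div_add_atTop_nhds_zero_nat (𝕜 := ℝ)).const_mul (2 * (δ / 2))
    rw [mul_zero] at this
    refine this.congr fun n => ?_
    simp only [b, r]; ring
  have hbδ : ∀ n, (b n).rOut ≤ δ := fun n => by
    have h1 : (1 / ((n : ℝ) + 1)) ≤ 1 := by
      rw [div_le_one (by positivity)]; linarith [n.cast_nonneg (α := ℝ)]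
    have : 2 * (δ / 2 * (1 / ((n : ℝ) + 1))) ≤ δ := by nlinarith
    exact this
  have hbK : ∀ᶠ n in atTop, (b n).rOut ≤ 2 * (b n).rIn := Eventually.of_forall fun n => le_rfl
  have haeU := ContDiffBump.ae_convolution_tendsto_right_of_locallyIntegrable hb0 hbK
    hUi.locallyIntegrable
  have haeG := ContDiffBump.ae_convolution_tendsto_right_of_locallyIntegrable hb0 hbK
    hGi.locallyIntegrable
  have hU1 := tendsto_integral_norm_sub_of_ae (fun n => integrable_mollify (b n) hUi) hUi haeU
    (fun n => integral_norm_mollify_le (b n) hUi)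
  have hG1 := tendsto_integral_norm_sub_of_ae (fun n => integrable_mollify (b n) hGi) hGi haeG
    (fun n => integral_norm_mollify_le (b n) hGi)
  have hcont : ∀ n, ContDiff ℝ 1 (mollify (b n) U) := fun n =>
    (contDiff_mollify (b n) hUi).of_le (by exact_mod_cast le_top)
  have hΦ' : Continuous (fderiv ℝ Φ) := hΦ.continuous_fderiv one_ne_zero
  have hηd : Continuous fun x => fderiv ℝ η x v :=
    (hη.continuous_fderiv (by simp)).clm_apply continuous_const
  have hηdc : HasCompactSupport fun x => fderiv ℝ η x v := hηc.fderiv_apply ℝ v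
  obtain ⟨M, hM⟩ := hη.continuous.bounded_above_of_compact_support hηc
  obtain ⟨M', hM'⟩ := hηd.bounded_above_of_compact_support hηdc
  have hM0 : 0 ≤ M := (norm_nonneg _).trans (hM 0)
  have hM'0 : 0 ≤ M' := (norm_nonneg _).trans (hM' 0)
  have hn : ∀ n, ∫ x, η x • fderiv ℝ Φ (mollify (b n) U x) (mollify (b n) G x) =
      - ∫ x, fderiv ℝ η x v • Φ (mollify (b n) U x) := fun n => by
    have hcomp : ContDiff ℝ 1 (fun x => Φ (mollify (b n) U x)) := hΦ.comp (hcont n)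
    rw [← integral_smul_fderiv_eq_neg_fderiv_smul_of_integrable]
    · congr 1; ext1 x
      by_cases hx : x ∈ tsupport η
      · congr 1
        have h1 : fderiv ℝ (fun x => Φ (mollify (b n) U x)) x =
            (fderiv ℝ Φ (mollify (b n) U x)).comp (fderiv ℝ (mollify (b n) U) x) :=
          fderiv_comp x (hΦ.differentiable one_ne_zero _) ((hcont n).differentiable one_ne_zero _)
        rw [h1, ContinuousLinearMap.comp_apply]
        congr 1
        exact (fderiv_mollify_of_isWeakGradient hΩ.measurableSet hg hu (b n)
          ((Metric.closedBall_subset_cthickening hx _).trans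
            ((Metric.cthickening_mono (hbδ n) _).trans hδs)) i).symm
      · simp [image_eq_zero_of_notMem_tsupport hx]
    · exact (hηd.smul hcomp.continuous).integrable_of_hasCompactSupport hηdc.smul_right
    · exact (hη.continuous.smul ((hcomp.continuous_fderiv one_ne_zero).clm_apply
        continuous_const)).integrable_of_hasCompactSupport hηc.smul_right
    · exact (hη.continuous.smul hcomp.continuous).integrable_of_hasCompactSupport hηc.smul_right
    · exact fun x _ => hη.differentiable (by simp) x
    · exact fun x _ => hcomp.differentiable one_ne_zero x
  have hΦU : Integrable fun x => Φ (U x) :=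
    (hUi.norm.const_mul C).mono' (hΦ.continuous.comp_aestronglyMeasurable hUi.1)
      (Eventually.of_forall fun x => by
        simpa [hΦ0] using norm_sub_le_of_fderiv hΦ hC (U x) 0)
  have hmeas : ∀ {f h : Rd d → ℂ}, Integrable f → Integrable h →
      AEStronglyMeasurable (fun x => fderiv ℝ Φ (f x) (h x)) := fun hf hh =>
    ((hΦ'.comp continuous_fst).clm_apply continuous_snd).comp_aestronglyMeasurable
      (hf.1.prodMk hh.1)
  have hint : ∀ {f h : Rd d → ℂ}, Integrable f → Integrable h →
      Integrable (fun x => fderiv ℝ Φ (f x) (h x)) := fun {f h} hf hh =>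
    (hh.norm.const_mul C).mono' (hmeas hf hh)
      (Eventually.of_forall fun x => (fderiv ℝ Φ (f x)).le_of_opNorm_le (hC _) _)
  have hηint : ∀ {f : Rd d → ℂ}, Integrable f → Integrable fun x => η x • f x := fun hf =>
    hf.bdd_smul M hη.continuous.aestronglyMeasurable (Eventually.of_forall hM)
  have hη'int : ∀ {f : Rd d → ℂ}, Integrable f → Integrable fun x => fderiv ℝ η x v • f x :=
    fun hf => hf.bdd_smul M' hηd.aestronglyMeasurable (Eventually.of_forall hM')
  have hR : Tendsto (fun n => ∫ x, fderiv ℝ η x v • Φ (mollify (b n) U x)) atTop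
      (𝓝 (∫ x, fderiv ℝ η x v • Φ (U x))) := by
    refine tendsto_integral_of_norm_sub_le
      (B := fun n x => M' * C * ‖mollify (b n) U x - U x‖) (fun n => ?_) (hη'int hΦU)
      (fun n => ((integrable_mollify (b n) hUi).sub hUi).norm.const_mul _) (fun n x => ?_) ?_
    · exact (hηd.smul (hΦ.continuous.comp (hcont n).continuous)).integrable_of_hasCompactSupport
        hηdc.smul_right
    · rw [← smul_sub, norm_smul, mul_assoc]
      exact mul_le_mul (hM' x) (norm_sub_le_of_fderiv hΦ hC _ _) (norm_nonneg _) hM'0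
    · simpa [integral_const_mul] using hU1.const_mul (M' * C)
  have hL : Tendsto (fun n => ∫ x, η x • fderiv ℝ Φ (mollify (b n) U x) (mollify (b n) G x)) atTop
      (𝓝 (∫ x, η x • fderiv ℝ Φ (U x) (G x))) := by
    have hD : ∀ n, Integrable fun x => ‖fderiv ℝ Φ (mollify (b n) U x) (G x) -
        fderiv ℝ Φ (U x) (G x)‖ := fun n =>
      ((hint (integrable_mollify (b n) hUi) hGi).sub (hint hUi hGi)).norm
    have hN : ∀ n, Integrable fun x => ‖mollify (b n) G x - G x‖ := fun n =>
      ((integrable_mollify (b n) hGi).sub hGi).norm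
    refine tendsto_integral_of_norm_sub_le
      (B := fun n x => M * C * ‖mollify (b n) G x - G x‖ +
        M * ‖fderiv ℝ Φ (mollify (b n) U x) (G x) - fderiv ℝ Φ (U x) (G x)‖)
      (fun n => hηint (hint (integrable_mollify (b n) hUi) (integrable_mollify (b n) hGi)))
      (hηint (hint hUi hGi)) (fun n => ((hN n).const_mul _).add ((hD n).const_mul _))
      (fun n x => ?_) ?_
    · rw [← smul_sub, norm_smul, mul_assoc, ← mul_add]
      refine mul_le_mul (hM x) ?_ (norm_nonneg _) hM0
      have h1 := (fderiv ℝ Φ (mollify (b n) U x)).le_of_opNorm_le (hC _)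
        (mollify (b n) G x - G x)
      rw [map_sub] at h1
      refine (norm_sub_le_norm_sub_add_norm_sub _ (fderiv ℝ Φ (mollify (b n) U x) (G x)) _).trans ?_
      gcongr
    · have hD0 : Tendsto (fun n => ∫ x, ‖fderiv ℝ Φ (mollify (b n) U x) (G x) -
          fderiv ℝ Φ (U x) (G x)‖) atTop (𝓝 (∫ _ : Rd d, (0 : ℝ))) := by
        refine tendsto_integral_of_dominated_convergence (fun x => 2 * C * ‖G x‖)
          (fun n => (hD n).1) (hGi.norm.const_mul _)
          (fun n => Eventually.of_forall fun x => ?_) ?_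
        · rw [norm_norm]
          refine (norm_sub_le _ _).trans ?_
          have h1 := (fderiv ℝ Φ (mollify (b n) U x)).le_of_opNorm_le (hC _) (G x)
          have h2 := (fderiv ℝ Φ (U x)).le_of_opNorm_le (hC _) (G x)
          linarith
        · filter_upwards [haeU] with x hx
          have h1 : Tendsto (fun n => fderiv ℝ Φ (mollify (b n) U x) (G x)) atTop
              (𝓝 (fderiv ℝ Φ (U x) (G x))) :=
            ((hΦ'.clm_apply continuous_const).tendsto (U x)).comp hx
          simpa using (h1.sub_const (fderiv ℝ Φ (U x) (G x))).norm
      have := (hG1.const_mul (M * C)).add (hD0.const_mul M)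
      simp only [integral_zero, mul_zero, add_zero] at this
      refine this.congr fun n => ?_
      rw [integral_add ((hN n).const_mul _) ((hD n).const_mul _), integral_const_mul,
        integral_const_mul]
  have key := tendsto_nhds_unique (hL.congr hn) hR.neg
  have hout : ∀ x, x ∉ Ω → x ∉ tsupport η := fun x hx h => hx (hηs h)
  have e1 : ∫ x, fderiv ℝ η x v • Φ (U x) = ∫ x in Ω, fderiv ℝ η x v • Φ (u x) := by
    rw [← integral_indicator hΩ.measurableSet]
    congr 1; ext x
    by_cases hx : x ∈ Ω
    · simp [hx, hU]
    · simp [hx, fderiv_of_notMem_tsupport ℝ (hout x hx)]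
  have e2 : ∫ x, η x • fderiv ℝ Φ (U x) (G x) = ∫ x in Ω, η x • fderiv ℝ Φ (u x) (g x i) := by
    rw [← integral_indicator hΩ.measurableSet]
    congr 1; ext x
    by_cases hx : x ∈ Ω
    · simp [hx, hU, hG]
    · simp [hx, image_eq_zero_of_notMem_tsupport (hout x hx)]
  rw [e1, e2] at key
  rw [eq_neg_iff_add_eq_zero, ← neg_eq_iff_add_eq_zero, ← key]

end Mollify

end WeakGradient

section FormDomain

/-! ### Nonlinear superposition on the form domains -/

theorem tendsto_eLpNorm_zero_of_dominated {α E : Type*} [MeasurableSpace α]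
    [NormedAddCommGroup E] {ν : Measure α} {p : ℝ≥0∞} (hp0 : p ≠ 0) (hp : p ≠ ⊤)
    {F : ℕ → α → E} {B : α → ℝ} (hF : ∀ n, AEStronglyMeasurable (F n) ν) (hB : MemLp B p ν)
    (hle : ∀ n, ∀ᵐ x ∂ν, ‖F n x‖ ≤ B x)
    (hlim : ∀ᵐ x ∂ν, Tendsto (fun n => F n x) atTop (𝓝 0)) :
    Tendsto (fun n => eLpNorm (F n) p ν) atTop (𝓝 0) := by
  have hpos : 0 < p.toReal := ENNReal.toReal_pos hp0 hp
  have h : Tendsto (fun n => ∫⁻ x, ‖F n x‖ₑ ^ p.toReal ∂ν) atTop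
      (𝓝 (∫⁻ _, (0 : ℝ≥0∞) ∂ν)) := by
    refine tendsto_lintegral_of_dominated_convergence' (fun x => ‖B x‖ₑ ^ p.toReal)
      (fun n => (hF n).enorm.pow_const _) (fun n => ?_)
      (lintegral_rpow_enorm_lt_top_of_eLpNorm_lt_top hp0 hp hB.2).ne ?_
    · filter_upwards [hle n] with x hx
      gcongr
      exact enorm_le_iff_norm_le.2 (hx.trans (le_abs_self _))
    · filter_upwards [hlim] with x hx
      have := (ENNReal.continuous_rpow_const (y := p.toReal)).tendsto _ |>.comp hx.enorm
      simpa [Function.comp_def, hpos] using this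
  have h2 := ((ENNReal.continuous_rpow_const (y := 1 / p.toReal)).tendsto _).comp h
  simp only [lintegral_zero, Function.comp_def] at h2
  rw [ENNReal.zero_rpow_of_pos (by positivity)] at h2
  exact h2.congr fun n => (eLpNorm_eq_lintegral_rpow_enorm_toReal hp0 hp).symm

variable {d : ℕ}

/-- A real-linear map applied to each coordinate. -/
def mapCoord (L : ℂ →L[ℝ] ℂ) (ξ : Cd d) : Cd d := WithLp.toLp 2 fun i => L (ξ i)

theorem norm_mapCoord_le {L : ℂ →L[ℝ] ℂ} {C : ℝ} (hL : ‖L‖ ≤ C) (ξ : Cd d) :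
    ‖mapCoord L ξ‖ ≤ C * ‖ξ‖ := by
  have hC : 0 ≤ C := (norm_nonneg _).trans hL
  rw [EuclideanSpace.norm_eq, EuclideanSpace.norm_eq, ← Real.sqrt_sq hC,
    ← Real.sqrt_mul (by positivity), Finset.mul_sum]
  refine Real.sqrt_le_sqrt (Finset.sum_le_sum fun i _ => ?_)
  rw [← mul_pow]
  exact pow_le_pow_left₀ (norm_nonneg _) (L.le_of_opNorm_le hL _) 2

theorem mapCoord_sub (L : ℂ →L[ℝ] ℂ) (ξ ζ : Cd d) :
    mapCoord L (ξ - ζ) = mapCoord L ξ - mapCoord L ζ := by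
  ext i; simp [mapCoord]

theorem continuous_mapCoord_fderiv {Φ : ℂ → ℂ} (hΦ : ContDiff ℝ 1 Φ) :
    Continuous fun q : ℂ × Cd d => mapCoord (fderiv ℝ Φ q.1) q.2 := by
  refine (PiLp.continuous_toLp 2 _).comp (continuous_pi fun i => ?_)
  exact ((hΦ.continuous_fderiv one_ne_zero).comp continuous_fst).clm_apply
    ((EuclideanSpace.proj (𝕜 := ℂ) i).continuous.comp continuous_snd)

theorem setIntegral_inter_of_tsupport_subset {Ω B : Set (Rd d)} (hΩ : MeasurableSet Ω)
    {η : Rd d → ℝ} (hη : tsupport η ⊆ B) {f : Rd d → ℂ} (hf : ∀ x ∉ tsupport η, f x = 0) :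
    ∫ x in Ω ∩ B, f x = ∫ x in Ω, f x :=
  (setIntegral_eq_of_subset_of_forall_sdiff_eq_zero hΩ Set.inter_subset_left
    fun x hx => hf x fun h => hx.2 ⟨hx.1, hη h⟩).symm

/-- The chain rule in `W^{1,2}`. -/
theorem IsWeakGradient.comp {Ω : Set (Rd d)} (hΩ : IsOpen Ω)
    {u : Rd d → ℂ} {g : Rd d → Cd d} (hg : IsWeakGradient Ω u g)
    (hu : MemLp u 2 (volume.restrict Ω)) (hgi : MemLp g 2 (volume.restrict Ω))
    {Φ : ℂ → ℂ} (hΦ : ContDiff ℝ 1 Φ) (hΦ0 : Φ 0 = 0) {C : ℝ} (hC : ∀ z, ‖fderiv ℝ Φ z‖ ≤ C) :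
    IsWeakGradient Ω (fun x => Φ (u x)) (fun x => mapCoord (fderiv ℝ Φ (u x)) (g x)) := by
  intro η hη hηc hηs i
  obtain ⟨R, hR⟩ := hηc.isCompact.isBounded.subset_ball (0 : Rd d)
  set B := Metric.ball (0 : Rd d) R
  have hΩm := hΩ.measurableSet
  have hfin : IsFiniteMeasure (volume.restrict (Ω ∩ B)) :=
    ⟨by simpa using (measure_mono Set.inter_subset_right).trans_lt measure_ball_lt_top⟩
  have hle : volume.restrict (Ω ∩ B) ≤ volume.restrict Ω :=
    Measure.restrict_mono Set.inter_subset_left le_rfl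
  have hw : IsWeakGradient (Ω ∩ B) u g := by
    intro φ hφ hφc hφs j
    have hφB := hφs.trans Set.inter_subset_right
    rw [setIntegral_inter_of_tsupport_subset hΩm hφB fun x hx => by
        simp [fderiv_of_notMem_tsupport ℝ hx],
      setIntegral_inter_of_tsupport_subset hΩm hφB fun x hx => by
        simp [image_eq_zero_of_notMem_tsupport hx]]
    exact hg φ hφ hφc (hφs.trans Set.inter_subset_left) j
  have hgj : ∀ j, IntegrableOn (fun x => g x j) (Ω ∩ B) := fun j =>
    (((EuclideanSpace.proj (𝕜 := ℂ) j).comp_memLp' (hgi.mono_measure hle))).integrable one_le_two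
  have h := hw.comp_of_integrableOn (hΩ.inter Metric.isOpen_ball)
    ((hu.mono_measure hle).integrable one_le_two) hgj hΦ hΦ0 hC η hη hηc
    (Set.subset_inter hηs hR) i
  rw [setIntegral_inter_of_tsupport_subset hΩm hR fun x hx => by
      simp [fderiv_of_notMem_tsupport ℝ hx],
    setIntegral_inter_of_tsupport_subset hΩm hR fun x hx => by
      simp [image_eq_zero_of_notMem_tsupport hx]] at h
  exact h

theorem IsWeakGradient.congr_ae {Ω : Set (Rd d)} {u u' : Rd d → ℂ} {g g' : Rd d → Cd d}
    (h : IsWeakGradient Ω u g) (hu : u' =ᵐ[volume.restrict Ω] u)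
    (hg : g' =ᵐ[volume.restrict Ω] g) : IsWeakGradient Ω u' g' := by
  intro η hη hηc hηs i
  have h1 : ∫ x in Ω, (fderiv ℝ η x (EuclideanSpace.single i 1)) • u' x =
      ∫ x in Ω, (fderiv ℝ η x (EuclideanSpace.single i 1)) • u x :=
    integral_congr_ae (hu.mono fun x hx => by simp only [hx])
  have h2 : ∫ x in Ω, η x • g' x i = ∫ x in Ω, η x • g x i :=
    integral_congr_ae (hg.mono fun x hx => by simp only [hx])
  rw [h1, h2]
  exact h η hη hηc hηs i

section Superposition

variable {Ω : Set (Rd d)} {Φ : ℂ → ℂ} {C : ℝ}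

theorem memLp_comp (hΦ : ContDiff ℝ 1 Φ) (hΦ0 : Φ 0 = 0) (hC : ∀ z, ‖fderiv ℝ Φ z‖ ≤ C)
    (u : LpΩ 2 Ω) : MemLp (fun x => Φ (u x)) 2 (volume.restrict Ω) :=
  (Lp.memLp u).of_le_mul (hΦ.continuous.comp_aestronglyMeasurable (Lp.aestronglyMeasurable u))
    (Eventually.of_forall fun x => by simpa [hΦ0] using norm_sub_le_of_fderiv hΦ hC (u x) 0)

theorem memLp_mapCoord_fderiv (hΦ : ContDiff ℝ 1 Φ) (hC : ∀ z, ‖fderiv ℝ Φ z‖ ≤ C)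
    (u : LpΩ 2 Ω) (g : L2Field Ω) :
    MemLp (fun x => mapCoord (fderiv ℝ Φ (u x)) (g x)) 2 (volume.restrict Ω) :=
  (Lp.memLp g).of_le_mul ((continuous_mapCoord_fderiv hΦ).comp_aestronglyMeasurable
    ((Lp.aestronglyMeasurable u).prodMk (Lp.aestronglyMeasurable g)))
    (Eventually.of_forall fun _ => norm_mapCoord_le (hC _) _)

/-- The pair `(Φ ∘ u, DΦ(u) ∇u)`. -/
def superpose (hΦ : ContDiff ℝ 1 Φ) (hΦ0 : Φ 0 = 0) (hC : ∀ z, ‖fderiv ℝ Φ z‖ ≤ C)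
    (w : LpΩ 2 Ω × L2Field Ω) : LpΩ 2 Ω × L2Field Ω :=
  ((memLp_comp hΦ hΦ0 hC w.1).toLp _, (memLp_mapCoord_fderiv hΦ hC w.1 w.2).toLp _)

theorem superpose_fst_ae (hΦ : ContDiff ℝ 1 Φ) (hΦ0 : Φ 0 = 0) (hC : ∀ z, ‖fderiv ℝ Φ z‖ ≤ C)
    (w : LpΩ 2 Ω × L2Field Ω) :
    (superpose hΦ hΦ0 hC w).1 =ᵐ[volume.restrict Ω] fun x => Φ (w.1 x) :=
  (memLp_comp hΦ hΦ0 hC w.1).coeFn_toLp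

theorem superpose_snd_ae (hΦ : ContDiff ℝ 1 Φ) (hΦ0 : Φ 0 = 0) (hC : ∀ z, ‖fderiv ℝ Φ z‖ ≤ C)
    (w : LpΩ 2 Ω × L2Field Ω) :
    (superpose hΦ hΦ0 hC w).2 =ᵐ[volume.restrict Ω]
      fun x => mapCoord (fderiv ℝ Φ (w.1 x)) (w.2 x) :=
  (memLp_mapCoord_fderiv hΦ hC w.1 w.2).coeFn_toLp

theorem superpose_mem_W12 (hΩ : IsOpen Ω) (hΦ : ContDiff ℝ 1 Φ) (hΦ0 : Φ 0 = 0)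
    (hC : ∀ z, ‖fderiv ℝ Φ z‖ ≤ C) {w : LpΩ 2 Ω × L2Field Ω} (hw : w ∈ W12 Ω) :
    superpose hΦ hΦ0 hC w ∈ W12 Ω :=
  (IsWeakGradient.comp hΩ hw (Lp.memLp w.1) (Lp.memLp w.2) hΦ hΦ0 hC).congr_ae
    (superpose_fst_ae hΦ hΦ0 hC w) (superpose_snd_ae hΦ hΦ0 hC w)

theorem superpose_mem_smoothD (hΩ : IsOpen Ω) {D : Set (Rd d)} (hΦs : ContDiff ℝ ∞ Φ)
    (hΦ : ContDiff ℝ 1 Φ) (hΦ0 : Φ 0 = 0)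
    (hC : ∀ z, ‖fderiv ℝ Φ z‖ ≤ C) {w : LpΩ 2 Ω × L2Field Ω} (hw : w ∈ smoothD Ω D) :
    superpose hΦ hΦ0 hC w ∈ smoothD Ω D := by
  obtain ⟨hw, φ, hφ, hφc, hφD, hwφ⟩ := hw
  have hs : tsupport (fun x => Φ (φ x)) ⊆ tsupport φ :=
    closure_mono fun x hx h0 => hx (by simp [h0, hΦ0])
  refine ⟨superpose_mem_W12 hΩ hΦ hΦ0 hC hw, fun x => Φ (φ x), hΦs.comp hφ,
    hφc.mono' (subset_closure.trans hs), hφD.mono_left hs, ?_⟩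
  filter_upwards [superpose_fst_ae hΦ hΦ0 hC w, hwφ] with x hx hx'
  rw [hx, hx']

theorem superpose_mem_sobolevD (hΩ : IsOpen Ω) {D : Set (Rd d)}
    (hΦ : ContDiff ℝ 1 Φ) (hΦ0 : Φ 0 = 0)
    (hC : ∀ z, ‖fderiv ℝ Φ z‖ ≤ C) {w : LpΩ 2 Ω × L2Field Ω} (hw : w ∈ sobolevD Ω D) :
    superpose hΦ hΦ0 hC w ∈ sobolevD Ω D := by
  refine ⟨superpose_mem_W12 hΩ hΦ hΦ0 hC hw.1, hw.2.mono_left fun x hx U hU h0 => hx U hU ?_⟩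
  filter_upwards [superpose_fst_ae hΦ hΦ0 hC w, h0] with y hy hy' hyU
  rw [hy, hy' hyU, hΦ0]

theorem superpose_mem_closure (hΦ : ContDiff ℝ 1 Φ) (hΦ0 : Φ 0 = 0)
    (hC : ∀ z, ‖fderiv ℝ Φ z‖ ≤ C) {S : Set (LpΩ 2 Ω × L2Field Ω)}
    (hS : ∀ w ∈ S, superpose hΦ hΦ0 hC w ∈ S) {v : LpΩ 2 Ω × L2Field Ω} (hv : v ∈ closure S) :
    superpose hΦ hΦ0 hC v ∈ closure S := by
  obtain ⟨w₀, hw₀S, hw₀⟩ := mem_closure_iff_seq_limit.1 hv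
  obtain ⟨ns, hns, hae⟩ := (tendstoInMeasure_of_tendsto_Lp
    ((continuous_fst.tendsto v).comp hw₀)).exists_seq_tendsto_ae
  set w := fun n => w₀ (ns n)
  have hw : Tendsto w atTop (𝓝 v) := hw₀.comp hns.tendsto_atTop
  have hw1 : Tendsto (fun n => ‖(w n).1 - v.1‖) atTop (𝓝 0) :=
    tendsto_iff_norm_sub_tendsto_zero.1 ((continuous_fst.tendsto v).comp hw)
  have hw2 : Tendsto (fun n => ‖(w n).2 - v.2‖) atTop (𝓝 0) :=
    tendsto_iff_norm_sub_tendsto_zero.1 ((continuous_snd.tendsto v).comp hw)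
  refine mem_closure_of_tendsto (f := fun n => superpose hΦ hΦ0 hC (w n)) (b := atTop) ?_
    (Eventually.of_forall fun n => hS _ (hw₀S _))
  refine (Prod.tendsto_iff _ _).2 ⟨?_, ?_⟩
  · rw [tendsto_iff_norm_sub_tendsto_zero]
    refine squeeze_zero (fun n => norm_nonneg _) (fun n => ?_) (by simpa using hw1.const_mul C)
    refine Lp.norm_le_mul_norm_of_ae_le_mul ?_
    filter_upwards [superpose_fst_ae hΦ hΦ0 hC (w n), superpose_fst_ae hΦ hΦ0 hC v,
      Lp.coeFn_sub (superpose hΦ hΦ0 hC (w n)).1 (superpose hΦ hΦ0 hC v).1,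
      Lp.coeFn_sub (w n).1 v.1] with x h1 h2 h3 h4
    rw [h3, h4, Pi.sub_apply, Pi.sub_apply, h1, h2]
    exact norm_sub_le_of_fderiv hΦ hC _ _
  · let c : ℕ → L2Field Ω := fun n => (memLp_mapCoord_fderiv hΦ hC (w n).1 v.2).toLp _
    have hc : Tendsto c atTop (𝓝 (superpose hΦ hΦ0 hC v).2) := by
      refine (Lp.tendsto_Lp_iff_tendsto_eLpNorm'' _ _ _
        (memLp_mapCoord_fderiv hΦ hC v.1 v.2)).2 ?_
      refine tendsto_eLpNorm_zero_of_dominated two_ne_zero ENNReal.ofNat_ne_top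
        (B := fun x => 2 * C * ‖v.2 x‖)
        (fun n => ((memLp_mapCoord_fderiv hΦ hC (w n).1 v.2).sub
          (memLp_mapCoord_fderiv hΦ hC v.1 v.2)).1)
        ((Lp.memLp v.2).norm.const_mul _) (fun n => Eventually.of_forall fun x => ?_) ?_
      · refine (norm_sub_le _ _).trans ?_
        have h1 := norm_mapCoord_le (hC ((w n).1 x)) (v.2 x)
        have h2 := norm_mapCoord_le (hC (v.1 x)) (v.2 x)
        linarith
      · filter_upwards [hae] with x hx
        have h1 : Tendsto (fun n => mapCoord (fderiv ℝ Φ ((w n).1 x)) (v.2 x)) atTop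
            (𝓝 (mapCoord (fderiv ℝ Φ (v.1 x)) (v.2 x))) :=
          (((continuous_mapCoord_fderiv hΦ).comp
            (continuous_id.prodMk continuous_const)).tendsto (v.1 x)).comp hx
        simpa using h1.sub_const (mapCoord (fderiv ℝ Φ (v.1 x)) (v.2 x))
    have hd : Tendsto (fun n => (superpose hΦ hΦ0 hC (w n)).2 - c n) atTop (𝓝 0) := by
      refine squeeze_zero_norm (fun n => ?_) (by simpa using hw2.const_mul C)
      refine Lp.norm_le_mul_norm_of_ae_le_mul ?_
      filter_upwards [superpose_snd_ae hΦ hΦ0 hC (w n),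
        (memLp_mapCoord_fderiv hΦ hC (w n).1 v.2).coeFn_toLp,
        Lp.coeFn_sub (superpose hΦ hΦ0 hC (w n)).2 (c n),
        Lp.coeFn_sub (w n).2 v.2] with x h1 h2 h3 h4
      rw [h3, h4, Pi.sub_apply, Pi.sub_apply, h1, h2, ← mapCoord_sub]
      exact norm_mapCoord_le (hC _) _
    simpa using hd.add hc

/-- The form domains are invariant under superposition with smooth functions that have a bounded
derivative and vanish at the origin. -/
theorem IsFormDomain.superpose_mem (hΩ : IsOpen Ω) {D : Set (Rd d)}
    {V : Set (LpΩ 2 Ω × L2Field Ω)} (hV : IsFormDomain Ω D V) (hΦs : ContDiff ℝ ∞ Φ)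
    (hΦ : ContDiff ℝ 1 Φ) (hΦ0 : Φ 0 = 0) (hC : ∀ z, ‖fderiv ℝ Φ z‖ ≤ C)
    {v : LpΩ 2 Ω × L2Field Ω} (hv : v ∈ V) : superpose hΦ hΦ0 hC v ∈ V := by
  rcases hV with rfl | rfl
  · exact ⟨superpose_mem_W12 hΩ hΦ hΦ0 hC hv.1, superpose_mem_closure hΦ hΦ0 hC
      (fun w hw => superpose_mem_smoothD hΩ hΦs hΦ hΦ0 hC hw) hv.2⟩
  · exact ⟨superpose_mem_W12 hΩ hΦ hΦ0 hC hv.1, superpose_mem_closure hΦ hΦ0 hC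
      (fun w hw => superpose_mem_sobolevD hΩ hΦ hΦ0 hC hw) hv.2⟩

end Superposition

end FormDomain

section FormTest

/-! ### The form and the regularized power -/

variable {d : ℕ}

theorem re_mul_inner_Jp_nonneg {p θ : ℝ} (h0 : 0 ≤ θ) (h1 : θ ≤ Real.pi / 2)
    {L : Cd d →L[ℂ] Cd d} (hL : pNumericalRange p L ⊆ sector θ) {c : ℂ}
    (hc : c ∈ sectorRotations θ) (ξ : Cd d) : 0 ≤ (c * inner ℂ (Jp p ξ) (L ξ)).re := by
  rcases eq_or_ne ξ 0 with rfl | hξ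
  · simp
  have hn : 0 < ‖ξ‖ := norm_pos_iff.2 hξ
  have hnc : (‖ξ‖ : ℂ) ≠ 0 := by exact_mod_cast hn.ne'
  set e : Cd d := ((‖ξ‖⁻¹ : ℝ) : ℂ) • ξ with he
  have hJ : Jp p ξ = (‖ξ‖ : ℂ) • Jp p e := by
    ext i
    apply Complex.ext <;> simp [Jp, he] <;> field_simp
  have hξe : ξ = (‖ξ‖ : ℂ) • e := by
    rw [he, smul_smul]; simp [hnc]
  have h := (mem_sector_iff h0 h1).1 (hL ⟨e, by simp [he, norm_smul, hn.ne'], rfl⟩) c hc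
  have key : inner ℂ (Jp p ξ) (L ξ) = ((‖ξ‖ ^ 2 : ℝ) : ℂ) * inner ℂ (Jp p e) (L e) := by
    rw [hJ]
    conv_lhs => rw [show L ξ = (‖ξ‖ : ℂ) • L e by rw [← map_smul, ← hξe]]
    rw [inner_smul_left, inner_smul_right, Complex.conj_ofReal]
    push_cast; ring
  rw [key, mul_left_comm, Complex.re_ofReal_mul]
  positivity

theorem re_mul_inner_mapCoord_nonneg {p : ℝ} (hp : 1 < p) {L : Cd d →L[ℂ] Cd d} {c : ℂ}
    (hL : ∀ ξ, 0 ≤ (c * inner ℂ (Jp p ξ) (L ξ)).re) {ε : ℝ} (hε : 0 < ε) (hε1 : ε ≤ 1) (z : ℂ)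
    (ξ : Cd d) :
    0 ≤ (c * inner ℂ (mapCoord (fderiv ℝ (regPower p ε) z) ξ) (L ξ)).re := by
  obtain ⟨m, s, hm0, hm1, hs, hD⟩ := fderiv_regPower (p := p) hε hε1 z
  set P := regRatio ε (‖z‖ ^ 2) ^ ((p - 2) / 2) with hP
  have hP0 : 0 ≤ P := Real.rpow_nonneg (regRatio_pos hε (by positivity)).le _
  have hss : s * starRingEnd ℂ s = 1 := by rw [Complex.mul_conj']; simp [hs]
  set ζ : Cd d := starRingEnd ℂ s • ξ with hζ
  have hξ : ξ = s • ζ := by rw [hζ, smul_smul, hss, one_smul]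
  set k₁ : ℝ := (1 + (p - 1) * m) / 2 with hk₁
  set k₂ : ℝ := (1 - m) / 2 with hk₂
  have hk₁0 : 0 ≤ k₁ := by
    have : 0 ≤ p - 1 := by linarith
    positivity
  have hk₂0 : 0 ≤ k₂ := by rw [hk₂]; linarith
  have hx : ∀ x : ℂ, x + (((p - 2) * m * x.re : ℝ) : ℂ) =
      k₁ * ⟨2 * x.re / p.conjExponent, 2 * x.im / p⟩ +
        k₂ * (-Complex.I * ⟨2 * (Complex.I * x).re / p.conjExponent, 2 * (Complex.I * x).im / p⟩) := by
    intro x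
    have hp0 : p ≠ 0 := by linarith
    have hp1 : p - 1 ≠ 0 := by linarith
    apply Complex.ext <;> simp [Real.conjExponent, hk₁, hk₂] <;> field_simp <;> ring
  have hmap : mapCoord (fderiv ℝ (regPower p ε) z) ξ =
      (P : ℂ) • s • ((k₁ : ℂ) • Jp p ζ + (k₂ : ℂ) • (-Complex.I) • Jp p (Complex.I • ζ)) := by
    ext i
    have h1 := hx (ζ i)
    have h2 : ξ i = s * ζ i := by rw [hξ]; simp
    have h3 : ζ i = starRingEnd ℂ s * ξ i := by rw [hζ]; simp
    simp only [mapCoord, Jp, PiLp.smul_apply, PiLp.add_apply, smul_eq_mul, hD]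
    rw [← h1, ← h3, h2]
    ring
  have hin : inner ℂ (mapCoord (fderiv ℝ (regPower p ε) z) ξ) (L ξ) =
      (P : ℂ) * (k₁ * inner ℂ (Jp p ζ) (L ζ) +
        k₂ * inner ℂ (Jp p (Complex.I • ζ)) (L (Complex.I • ζ))) := by
    rw [hmap, show L ξ = s • L ζ by rw [← map_smul, ← hξ], map_smul L Complex.I ζ]
    simp only [inner_smul_left, inner_smul_right, inner_add_left, map_neg, Complex.conj_ofReal,
      Complex.conj_I, neg_neg]
    linear_combination (P * (k₁ * inner ℂ (Jp p ζ) (L ζ) +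
        k₂ * (Complex.I * inner ℂ (Jp p (Complex.I • ζ)) (L ζ)))) * hss
  have e : c * ((P : ℂ) * (k₁ * inner ℂ (Jp p ζ) (L ζ) +
        k₂ * inner ℂ (Jp p (Complex.I • ζ)) (L (Complex.I • ζ)))) =
      (P : ℂ) * ((k₁ : ℂ) * (c * inner ℂ (Jp p ζ) (L ζ)) +
        (k₂ : ℂ) * (c * inner ℂ (Jp p (Complex.I • ζ)) (L (Complex.I • ζ)))) := by ring
  rw [hin, e, Complex.re_ofReal_mul, Complex.add_re, Complex.re_ofReal_mul, Complex.re_ofReal_mul]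
  exact mul_nonneg hP0 (add_nonneg (mul_nonneg hk₁0 (hL _)) (mul_nonneg hk₂0 (hL _)))

theorem re_const_mul_integral_nonneg {α : Type*} [MeasurableSpace α] {ν : Measure α} {F : α → ℂ}
    {c : ℂ} (h : ∀ᵐ x ∂ν, 0 ≤ (c * F x).re) : 0 ≤ (c * ∫ x, F x ∂ν).re := by
  by_cases hF : Integrable F ν
  · rw [← integral_const_mul, ← RCLike.re_eq_complex_re, ← integral_re (hF.const_mul c)]
    exact integral_nonneg_of_ae h
  · simp [integral_undef hF]

/-- Testing the equation `A u = f` with the regularized power of `u`. -/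
theorem re_mul_integral_regPower_nonneg {Ω D : Set (Rd d)} (hΩ : IsOpen Ω)
    {V : Set (LpΩ 2 Ω × L2Field Ω)} (hV : IsFormDomain Ω D V) {μ : Rd d → Cd d →L[ℂ] Cd d}
    {p : ℝ} (hp : 1 < p) {c : ℂ}
    (hμ : ∀ᵐ x ∂(volume.restrict Ω), ∀ ξ, 0 ≤ (c * inner ℂ (Jp p ξ) (μ x ξ)).re)
    {u f : LpΩ 2 Ω} (huf : (u, f) ∈ formOperator Ω μ V) {ε : ℝ} (hε : 0 < ε) (hε1 : ε ≤ 1) :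
    0 ≤ (c * ∫ x in Ω, starRingEnd ℂ (regPower p ε (u x)) * f x).re := by
  obtain ⟨w, hwV, hwu, hw⟩ := huf
  have hΦs : ContDiff ℝ ∞ (regPower p ε) := contDiff_regPower hε
  have hΦ : ContDiff ℝ 1 (regPower p ε) := contDiff_regPower hε |>.of_le (by exact_mod_cast le_top)
  have hC := norm_fderiv_regPower_le (p := p) hε hε1
  have h := hw _ (hV.superpose_mem hΩ hΦs hΦ (regPower_zero p ε) hC hwV)
  rw [L2.inner_def] at h
  have e : ∫ x in Ω, starRingEnd ℂ (regPower p ε (u x)) * f x = ∫ x in Ω,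
      inner ℂ ((superpose hΦ (regPower_zero p ε) hC w).1 x) (f x) := by
    refine integral_congr_ae ?_
    filter_upwards [superpose_fst_ae hΦ (regPower_zero p ε) hC w] with x hx
    simp only at hwu
    rw [hx, hwu, RCLike.inner_apply, mul_comm]
  rw [e, ← h, form]
  refine re_const_mul_integral_nonneg ?_
  filter_upwards [superpose_snd_ae hΦ (regPower_zero p ε) hC w, hμ] with x hx hμx
  rw [hx]
  exact re_mul_inner_mapCoord_nonneg hp hμx hε hε1 _ _

end FormTest

section Realization

/-! ### Accretivity of the realization in `L^p` -/

section Consistency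

variable {α : Type*} [MeasurableSpace α] {ν : Measure α} {p q : ℝ≥0∞}

/-- The subspace `L^p ∩ L^q`, as the diagonal of `L^p × L^q`. -/
def aeEqSubmodule (ν : Measure α) (p q : ℝ≥0∞) [Fact (1 ≤ p)] [Fact (1 ≤ q)] :
    Submodule ℂ (Lp ℂ p ν × Lp ℂ q ν) where
  carrier := {w | w.1 =ᵐ[ν] w.2}
  zero_mem' := by
    filter_upwards [Lp.coeFn_zero ℂ p ν, Lp.coeFn_zero ℂ q ν] with x h1 h2
    exact h1.trans h2.symm
  add_mem' := by
    intro v w hv hw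
    change (v + w).1 =ᵐ[ν] (v + w).2
    filter_upwards [Lp.coeFn_add v.1 w.1, Lp.coeFn_add v.2 w.2, hv, hw] with x h1 h2 h3 h4
    rw [Prod.fst_add, Prod.snd_add, h1, h2, Pi.add_apply, Pi.add_apply, h3, h4]
  smul_mem' := by
    intro c w hw
    change (c • w).1 =ᵐ[ν] (c • w).2
    filter_upwards [Lp.coeFn_smul c w.1, Lp.coeFn_smul c w.2, hw] with x h1 h2 h3
    rw [Prod.smul_fst, Prod.smul_snd, h1, h2, Pi.smul_apply, Pi.smul_apply, h3]

theorem isClosed_aeEqSubmodule [Fact (1 ≤ p)] [Fact (1 ≤ q)] :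
    IsClosed (aeEqSubmodule ν p q : Set (Lp ℂ p ν × Lp ℂ q ν)) := by
  refine IsSeqClosed.isClosed fun w v hw hv => ?_
  obtain ⟨n₁, hn₁, h₁⟩ := (tendstoInMeasure_of_tendsto_Lp
    ((continuous_fst.tendsto v).comp hv)).exists_seq_tendsto_ae
  obtain ⟨n₂, hn₂, h₂⟩ := (tendstoInMeasure_of_tendsto_Lp
    (((continuous_snd.tendsto v).comp hv).comp hn₁.tendsto_atTop)).exists_seq_tendsto_ae
  have hall : ∀ᵐ x ∂ν, ∀ n, (w n).1 x = (w n).2 x := ae_all_iff.2 hw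
  change v.1 =ᵐ[ν] v.2
  filter_upwards [h₁, h₂, hall] with x h1 h2 h3
  refine tendsto_nhds_unique (h1.comp hn₂.tendsto_atTop) (h2.congr fun n => ?_)
  exact (h3 _).symm

/-- `L^p ∩ L^q` is dense in `L^q`. -/
theorem dense_setOf_ae_eq [Fact (1 ≤ p)] [Fact (1 ≤ q)] (hp : p ≠ ⊤) (hq : q ≠ ⊤) :
    Dense {g : Lp ℂ q ν | ∃ f : Lp ℂ p ν, f =ᵐ[ν] g} := by
  refine (Lp.simpleFunc.dense (E := ℂ) (μ := ν) hq).mono fun g hg => ?_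
  set s : SimpleFunc α ℂ := Lp.simpleFunc.toSimpleFunc ⟨g, hg⟩
  have hsq : MemLp s q ν := Lp.simpleFunc.memLp ⟨g, hg⟩
  have hp0 : p ≠ 0 := (zero_lt_one.trans_le Fact.out).ne'
  have hq0 : q ≠ 0 := (zero_lt_one.trans_le Fact.out).ne'
  have hsp : MemLp s p ν :=
    (SimpleFunc.memLp_iff hp0 hp).2 ((SimpleFunc.memLp_iff hq0 hq).1 hsq)
  refine ⟨hsp.toLp s, hsp.coeFn_toLp.trans ?_⟩
  exact Lp.simpleFunc.toSimpleFunc_eq_toFun ⟨g, hg⟩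

end Consistency

variable {d : ℕ}

/-- Testing the equation `A v = g` with `|v|^{p-2} v`, for `v, g ∈ L^2 ∩ L^p`. -/
theorem re_mul_dualPair_nonneg {Ω D : Set (Rd d)} (hΩ : IsOpen Ω)
    {V : Set (LpΩ 2 Ω × L2Field Ω)} (hV : IsFormDomain Ω D V) {μ : Rd d → Cd d →L[ℂ] Cd d}
    {p : ℝ≥0∞} (hp : 1 < p) (hp' : p < ⊤) {c : ℂ}
    (hμ : ∀ᵐ x ∂(volume.restrict Ω), ∀ ξ, 0 ≤ (c * inner ℂ (Jp p.toReal ξ) (μ x ξ)).re)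
    {v g : LpΩ 2 Ω} (hvg : (v, g) ∈ formOperator Ω μ V) {v' g' : LpΩ p Ω}
    (hv : v =ᵐ[volume.restrict Ω] v') (hg : g =ᵐ[volume.restrict Ω] g') :
    0 ≤ (c * dualPair v' g').re := by
  have hr := one_lt_toReal hp hp'
  set K : ℝ := (2⁻¹ : ℝ) ^ ((p.toReal - 2) / 2) + 2 ^ ((p.toReal - 2) / 2)
  have hint : Integrable (fun x => K * (‖v x‖ * ‖g x‖ +
      ‖starRingEnd ℂ (powerMap p.toReal (v' x)) * g' x‖)) (volume.restrict Ω) :=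
    (((Lp.memLp v).norm.integrable_mul (Lp.memLp g).norm).add
      (integrable_dualPair hp hp' v' g').norm).const_mul K
  have hn0 : ∀ n : ℕ, (0 : ℝ) < 1 / ((n : ℝ) + 1) := fun n => by positivity
  have hn1 : ∀ n : ℕ, 1 / ((n : ℝ) + 1) ≤ 1 := fun n => by
    rw [div_le_one (by positivity)]
    linarith [n.cast_nonneg (α := ℝ)]
  have hlim : Tendsto (fun n : ℕ => ∫ x in Ω,
      starRingEnd ℂ (regPower p.toReal (1 / ((n : ℝ) + 1)) (v x)) * g x) atTop
      (𝓝 (dualPair v' g')) := by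
    refine tendsto_integral_of_dominated_convergence _ (fun n => ?_) hint (fun n => ?_) ?_
    · exact ((Complex.continuous_conj.comp
        (contDiff_regPower (hn0 n)).continuous).comp_aestronglyMeasurable
          (Lp.aestronglyMeasurable v)).mul (Lp.aestronglyMeasurable g)
    · filter_upwards [hv, hg] with x hvx hgx
      rw [norm_mul, norm_mul, RCLike.norm_conj, RCLike.norm_conj, ← hvx, ← hgx, ← add_mul,
        ← mul_assoc]
      exact mul_le_mul_of_nonneg_right (norm_regPower_le (hn0 n) (hn1 n) _) (norm_nonneg _)
    · filter_upwards [hv, hg] with x hvx hgx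
      rw [← hvx, ← hgx]
      exact ((Complex.continuous_conj.tendsto _).comp
        (tendsto_regPower p.toReal (v x))).mul_const (g x)
  refine ge_of_tendsto ((Complex.continuous_re.tendsto _).comp (hlim.const_mul c))
    (Eventually.of_forall fun n => ?_)
  exact re_mul_integral_regPower_nonneg hΩ hV hr hμ hvg (hn0 n) (hn1 n)

theorem norm_le_of_isLpRealization {Ω D : Set (Rd d)} (hΩ : IsOpen Ω)
    {V : Set (LpΩ 2 Ω × L2Field Ω)} (hV : IsFormDomain Ω D V) {μ : Rd d → Cd d →L[ℂ] Cd d}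
    {p : ℝ≥0∞} [Fact (1 ≤ p)] (hp : 1 < p) (hp' : p < ⊤) {c : ℂ}
    (hμ : ∀ᵐ x ∂(volume.restrict Ω), ∀ ξ, 0 ≤ (c * inner ℂ (Jp p.toReal ξ) (μ x ξ)).re)
    {Ap : Set (LpΩ p Ω × LpΩ p Ω)} (hAp : IsLpRealization (formOperator Ω μ V) Ap)
    {u f : LpΩ p Ω} (huf : (u, f) ∈ Ap) {t : ℝ} (ht : 0 ≤ t) :
    ‖u‖ ≤ ‖u + ((t : ℂ) * c) • f‖ := by
  obtain ⟨T, S, hT, hA, hS, hTS, rfl⟩ := hAp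
  refine norm_le_of_dense_orbitIntegral hS
    (dense_setOf_ae_eq (p := 2) ENNReal.ofNat_ne_top hp'.ne) ?_ huf
  rintro g ⟨g₂, hg⟩ h
  have hmem := orbitIntegral_mem_negGenerator hT h g₂
  rw [hA] at hmem
  refine norm_le_norm_add_smul hp hp' (re_mul_dualPair_nonneg hΩ hV hp hp' hμ hmem ?_ ?_) ht
  · exact orbitIntegral_mem_of_isClosed hT hS (aeEqSubmodule _ 2 p) isClosed_aeEqSubmodule
      (fun s => hTS s g₂ g hg) h
  · exact (aeEqSubmodule _ 2 p).sub_mem (x := (g₂, g)) (y := (T h g₂, S h g)) hg (hTS h g₂ g hg)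

end Realization

end EllipticLp

end

open EllipticLp in
theorem theorem3p22 {d : ℕ} (Ω D : Set (Rd d)) (hΩ : IsOpen Ω)
    (hD : IsClosed D) (hDΩ : D ⊆ frontier Ω)
    (V : Set (LpΩ 2 Ω × L2Field Ω)) (hV : IsFormDomain Ω D V)
    (μ : Rd d → Cd d →L[ℂ] Cd d)
    (hμ_meas : AEStronglyMeasurable μ (volume.restrict Ω))
    (hμ_bdd : ∃ M : ℝ, ∀ᵐ x ∂(volume.restrict Ω), ‖μ x‖ ≤ M)
    (hμ_ell : ∃ m : ℝ, 0 < m ∧ ∀ᵐ x ∂(volume.restrict Ω), ∀ ξ : Cd d,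
      m * ‖ξ‖ ^ 2 ≤ (inner ℂ ξ (μ x ξ)).re)
    (p : ℝ≥0∞) [Fact (1 ≤ p)] (hp_one : 1 < p) (hp_top : p < ⊤)
    (θ : ℝ) (hθ_nonneg : 0 ≤ θ) (hθ_le : θ ≤ Real.pi / 2)
    (hN : ∀ᵐ x ∂(volume.restrict Ω), pNumericalRange p.toReal (μ x) ⊆ sector θ)
    (Ap : Set (LpΩ p Ω × LpΩ p Ω)) (hAp : IsLpRealization (formOperator Ω μ V) Ap) :
    numericalRange Ap ⊆ sector θ := by
  rintro z ⟨u, f, huf, hu, φ, hφ, rfl⟩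
  refine (mem_sector_iff hθ_nonneg hθ_le).2 fun c hc => ?_
  have h : 0 ≤ (φ (c • f)).re := by
    refine re_dualityMap_nonneg hp_one hp_top hu (fun t ht => ?_) hφ
    rw [← hu, smul_smul]
    exact norm_le_of_isLpRealization hΩ hV hp_one hp_top
      (hN.mono fun x hx => re_mul_inner_Jp_nonneg hθ_nonneg hθ_le hx hc) hAp huf ht.le
  rwa [map_smul, smul_eq_mul] at h
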